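/- Let $\langle v,w\rangle=-v_1w_1-v_2w_2+v_3w_3+v_4w_4$ on $\mathbb C^4$ and $(v,w)=\langle v,\bar w\rangle$. Let $\mathbb{CH}^3_1=\{[v]\in\mathbb{CP}^3: (v,v)<0\}$, with the (indefinite) Kähler structure induced from $(\cdot,\cdot)$ by the Hopf fibration $\{v:(v,v)=-1\}\to\mathbb{CH}^3_1$, and let $Q_2^*$ be the connected component containing $[1:i:0:0]$ of $\{[v]\in\mathbb{CH}^3_1:\langle v,v\rangle=0\}$, with the induced (positive definite) Kähler structure. Let $M$ be a Riemann surface and $f:M\to Q_2^*$ a conformal Lagrangian immersion. Let $D\subset M$ be a coordinate domain with holomorphic coordinate $z=x+iy$. * A *horizontal lift* of $f$ on $D$ is a smooth $\mathfrak f:D\to\mathbb C^4$ with $f=[\mathfrak f]$, $(\mathfrak f,\mathfrak f)=-1$ and $(\mathfrak f_z,\mathfrak f)=(\mathfrak f_{\bar z},\mathfrak f)=0$. Put $\alpha=\langle\mathfrak f_z,\mathfrak f_z\rangle$ and $\beta=\langle\mathfrak f_z,\mathfrak f_{\bar z}\rangle$. * A *frame* of $f$ on $D$ is a smooth map $\mathcal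 F$ from $D$ to the group $\mathrm O(2,2)$ of real matrices with $\mathcal F^T\eta\mathcal F=\eta$, $\eta=\mathrm{diag}(-1,-1,1,1)$, whose first two columns $\mathcal F_1,\mathcal F_2$ satisfy $f=[\mathcal F_1+i\mathcal F_2]$. Decompose $\omega=\mathcal F^{-1}d\mathcal F=\omega_{\mathfrak k}+\omega_{\mathfrak p}$ into the $(+1)$- and $(-1)$-eigenparts of $\mathrm{Ad}\,\mathrm{diag}(1,1,-1,-1)$, let $\omega_{\mathfrak p}',\omega_{\mathfrak p}''$ be the $(1,0)$- and $(0,1)$-parts of $\omega_{\mathfrak p}$, and for $\lambda\in\mathbb S^1$ put $\omega^\lambda=\lambda^{-1}\omega_{\mathfrak p}'+\omega_{\mathfrak k}+\lambda\,\omega_{\mathfrak p}''$. Say that $\beta$ has constant phase on $D$ if there are a constant $\theta\in\mathbb R$ and a function $t:D\to\mathbb R$ with $\beta=t\,e^{i\theta}$ on $D$. **Local statement.** If $D$ is connected, $\mathfrak f$ is a horizontal lift and $\mathcal F$ a frame of $f$ on $D$, then the following are equivalent: 1. $f|_D$ is minimal, i.e. its mean curvature vector (half the trace of the second fundamental form)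 vanishes; 2. the connections $d+\omega^\lambda$ are flat on $D$ for all $\lambda\in\mathbb S^1$; 3. $\alpha\,dz^2$ is holomorphic on $D$ and $\beta$ has constant phase on $D$. If moreover $\beta$ has no zeros on $D$ (equivalently, $|\alpha|^2<(\mathfrak f_z,\mathfrak f_z)^2$ on $D$), then 1 and 2 are also equivalent to: $\alpha\,dz^2$ is holomorphic and $\arg\beta$ is constant on $D$. **Global statement.** The following are equivalent: (1) $f$ is minimal; (2) for every coordinate domain $D$ and every frame of $f$ on $D$ the connections $d+\omega^\lambda$ are flat for all $\lambda\in\mathbb S^1$; (3) for every connected coordinate domain $D$ and every horizontal lift of $f$ on $D$, $\alpha\,dz^2$ is holomorphic and $\beta$ has constant phase on $D$. -/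

import Mathlib

open scoped Manifold ContDiff Matrix LinearAlgebra.Projectivization

noncomputable section

namespace HypQuadric

/-! ### The complex hyperbolic quadric -/

/-- The complex bilinear form `⟨v, w⟩ = -v₁w₁ - v₂w₂ + v₃w₃ + v₄w₄` on `ℂ⁴₂`. -/
def bil (v w : Fin 4 → ℂ) : ℂ := -(v 0 * w 0) - v 1 * w 1 + v 2 * w 2 + v 3 * w 3

/-- The Hermitian form `(v, w) = ⟨v, w̄⟩` of signature `(2, 2)`. -/
def herm (v w : Fin 4 → ℂ) : ℂ := bil v (star w)

/-- The set of all nonzero vectors spanning the points of the quadric `⟨v, v⟩ = 0` in the space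
`ℂH³₁` of negative lines: `(v, v) < 0` and `⟨v, v⟩ = 0`. -/
def quadricCone : Set (Fin 4 → ℂ) := {v | (herm v v).re < 0 ∧ bil v v = 0}

/-- The complex hyperbolic quadric `Q₂*`: a connected component (the one containing
`[1 : i : 0 : 0]`) of the quadric `⟨v, v⟩ = 0` in `ℂH³₁ ⊆ ℂP³`. As the fibres `ℂ \ {0}` of the
cone over the quadric are connected, it is the image of a connected component of the cone. -/
def Q2star : Set (ℙ ℂ (Fin 4 → ℂ)) :=
  {p | ∃ v ∈ connectedComponentIn quadricCone ![1, Complex.I, 0, 0],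
    ∃ hv : v ≠ 0, p = Projectivization.mk ℂ v hv}

/-! ### Complex derivatives of functions of `z = x + i y` -/

section Derivatives

variable {E : Type*} [NormedAddCommGroup E] [NormedSpace ℂ E]

/-- `∂_z g = (1/2) (∂_x g - i ∂_y g)`. -/
def dz (g : ℂ → E) (z : ℂ) : E :=
  (1 / 2 : ℂ) • (fderiv ℝ g z 1 - Complex.I • fderiv ℝ g z Complex.I)

/-- `∂_z̄ g = (1/2) (∂_x g + i ∂_y g)`. -/
def dzbar (g : ℂ → E) (z : ℂ) : E :=
  (1 / 2 : ℂ) • (fderiv ℝ g z 1 + Complex.I • fderiv ℝ g z Complex.I)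

end Derivatives

/-- Entrywise `∂_z` of a matrix-valued function. -/
def matDz (A : ℂ → Matrix (Fin 4) (Fin 4) ℂ) (z : ℂ) : Matrix (Fin 4) (Fin 4) ℂ :=
  Matrix.of fun i j => dz (fun w => A w i j) z

/-- Entrywise `∂_z̄` of a matrix-valued function. -/
def matDzbar (A : ℂ → Matrix (Fin 4) (Fin 4) ℂ) (z : ℂ) : Matrix (Fin 4) (Fin 4) ℂ :=
  Matrix.of fun i j => dzbar (fun w => A w i j) z

/-! ### Geometry of `Q₂*` through the indefinite Hopf fibration

A tangent vector of `ℂH³₁` at `[w]`, `(w, w) = -1`, is represented by its horizontal lift at `w`,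
a vector `v` with `(v, w) = 0`; the representative at `cw`, `|c| = 1`, is then `cv`. The Kähler
structure of `ℂH³₁` is given by the restriction of `( , )` to horizontal vectors: the metric is
its real part and the Kähler form is, up to sign, its imaginary part. The tangent vectors of the
quadric are those with also `⟨v, w⟩ = (v, w̄) = 0`. -/

/-- Projection of `v` onto the horizontal space at `w`, where `(w, w) = -1`. -/
def hor (w v : Fin 4 → ℂ) : Fin 4 → ℂ := v + herm v w • w

/-- Orthogonal projection of `v` onto the space of (horizontal lifts of) tangent vectors of the
quadric at `w`, that is, the orthogonal complement of `w` and `w̄`, where `(w, w) = -1` and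
`⟨w, w⟩ = 0`. -/
def tanProj (w v : Fin 4 → ℂ) : Fin 4 → ℂ := v + herm v w • w + herm v (star w) • star w

/-- The differential of the map `z ↦ [F z]` at `z` in the direction `X`, as a horizontal vector
at `F z`. -/
def diffMap (F : ℂ → Fin 4 → ℂ) (X z : ℂ) : Fin 4 → ℂ := hor (F z) (fderiv ℝ F z X)

/-- The pull-back along `z ↦ [F z]` of the Hermitian form of `ℂH³₁`. -/
def inducedForm (F : ℂ → Fin 4 → ℂ) (z X Y : ℂ) : ℂ := herm (diffMap F X z) (diffMap F Y z)

/-- The Levi-Civita covariant derivative `∇_X V` in the quadric at `z` of a vector field `V` along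
`z ↦ [F z]` (`V z` being the horizontal representative at `F z`). For a horizontal lift `F` it is
the projection of the flat derivative; the term `(dF X, F) V` accounts for the phase by which a
general lift differs from a horizontal one along a curve. -/
def covDeriv (F V : ℂ → Fin 4 → ℂ) (X z : ℂ) : Fin 4 → ℂ :=
  tanProj (F z) (fderiv ℝ V z X + herm (fderiv ℝ F z X) (F z) • V z)

/-- The component of `v` normal to the surface `z ↦ [F z]`, for `z` a conformal coordinate. -/
def normalPart (F : ℂ → Fin 4 → ℂ) (z : ℂ) (v : Fin 4 → ℂ) : Fin 4 → ℂ :=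
  v - (((herm v (diffMap F 1 z)).re / (inducedForm F z 1 1).re : ℝ) : ℂ) • diffMap F 1 z
    - (((herm v (diffMap F Complex.I z)).re / (inducedForm F z Complex.I Complex.I).re : ℝ) : ℂ) •
      diffMap F Complex.I z

/-- The second fundamental form `(∇_X df(Y))^⊥` on constant vectors `X`, `Y`. -/
def secondForm (F : ℂ → Fin 4 → ℂ) (z X Y : ℂ) : Fin 4 → ℂ :=
  normalPart F z (covDeriv F (diffMap F Y) X z)

/-- The mean curvature vector, half of the trace of the second fundamental form with respect to
the induced metric `E (dx² + dy²)`, `E = g(∂_x, ∂_x)`, for `z = x + i y` a conformal coordinate. -/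
def meanCurvature (F : ℂ → Fin 4 → ℂ) (z : ℂ) : Fin 4 → ℂ :=
  ((1 / (2 * (inducedForm F z 1 1).re) : ℝ) : ℂ) •
    (secondForm F z 1 1 + secondForm F z Complex.I Complex.I)

/-! ### Maps from a Riemann surface -/

section Surface

variable {M : Type*} [TopologicalSpace M] [ChartedSpace ℂ M]

/-- `e` is a holomorphic coordinate `z` on the open subset `e.source` of the Riemann surface `M`,
and `F : e.target → ℍ⁷₃(-1)` is a smooth lift of `f`, written in that coordinate. -/
structure IsLift (f : M → ℙ ℂ (Fin 4 → ℂ)) (e : OpenPartialHomeomorph M ℂ)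
    (F : ℂ → Fin 4 → ℂ) : Prop where
  chart : e ∈ IsManifold.maximalAtlas 𝓘(ℂ) ω M
  smooth : ContDiffOn ℝ ∞ F e.target
  unit : ∀ z ∈ e.target, herm (F z) (F z) = -1
  lift : ∀ z ∈ e.target, ∃ h : F z ≠ 0, f (e.symm z) = Projectivization.mk ℂ (F z) h

/-- `F` is a horizontal lift of `f` in the coordinate `e`. -/
structure IsHorizontalLift (f : M → ℙ ℂ (Fin 4 → ℂ)) (e : OpenPartialHomeomorph M ℂ)
    (F : ℂ → Fin 4 → ℂ) : Prop extends IsLift f e F where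
  horizontal : ∀ z ∈ e.target, herm (dz F z) (F z) = 0 ∧ herm (dzbar F z) (F z) = 0

/-- `f` is smooth: it has smooth local lifts. -/
def IsSmoothMap (f : M → ℙ ℂ (Fin 4 → ℂ)) : Prop :=
  ∀ p : M, ∃ (e : OpenPartialHomeomorph M ℂ) (F : ℂ → Fin 4 → ℂ), IsLift f e F ∧ p ∈ e.source

/-- The differential of `f` is injective at every point. -/
def IsImmersionMap (f : M → ℙ ℂ (Fin 4 → ℂ)) : Prop :=
  ∀ (e : OpenPartialHomeomorph M ℂ) (F : ℂ → Fin 4 → ℂ), IsLift f e F →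
    ∀ z ∈ e.target, ∀ X : ℂ, diffMap F X z = 0 → X = 0

/-- The induced metric (the real part of the induced form) is a multiple of `dx² + dy²` in every
holomorphic coordinate `z = x + i y`. -/
def IsConformalMap (f : M → ℙ ℂ (Fin 4 → ℂ)) : Prop :=
  ∀ (e : OpenPartialHomeomorph M ℂ) (F : ℂ → Fin 4 → ℂ), IsLift f e F → ∀ z ∈ e.target,
    (inducedForm F z 1 1).re = (inducedForm F z Complex.I Complex.I).re ∧
      (inducedForm F z 1 Complex.I).re = 0

/-- The pull-back of the Kähler form (the imaginary part of the induced form) vanishes. -/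
def IsLagrangianMap (f : M → ℙ ℂ (Fin 4 → ℂ)) : Prop :=
  ∀ (e : OpenPartialHomeomorph M ℂ) (F : ℂ → Fin 4 → ℂ), IsLift f e F → ∀ z ∈ e.target,
    ∀ X Y : ℂ, (inducedForm F z X Y).im = 0

/-- A conformal Lagrangian immersion of a Riemann surface into `Q₂*`. -/
structure IsConformalLagrangianImmersion (f : M → ℙ ℂ (Fin 4 → ℂ)) : Prop where
  mem_quadric : ∀ p, f p ∈ Q2star
  smooth : IsSmoothMap f
  immersion : IsImmersionMap f
  conformal : IsConformalMap f
  lagrangian : IsLagrangianMap f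

/-- `f` is minimal on the open set `S`: its mean curvature vector vanishes at the points
of `S`. -/
def IsMinimalOn (f : M → ℙ ℂ (Fin 4 → ℂ)) (S : Set M) : Prop :=
  ∀ (e : OpenPartialHomeomorph M ℂ) (F : ℂ → Fin 4 → ℂ), IsLift f e F →
    ∀ z ∈ e.target, e.symm z ∈ S → meanCurvature F z = 0

/-- `f` is minimal: its mean curvature vector vanishes identically. -/
def IsMinimal (f : M → ℙ ℂ (Fin 4 → ℂ)) : Prop := IsMinimalOn f Set.univ

/-! ### The quadratic differential and the function `β` -/

/-- `α = ⟨F_z, F_z⟩`. -/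
def alphaFun (F : ℂ → Fin 4 → ℂ) (z : ℂ) : ℂ := bil (dz F z) (dz F z)

/-- `β = ⟨F_z, F_z̄⟩`. -/
def betaFun (F : ℂ → Fin 4 → ℂ) (z : ℂ) : ℂ := bil (dz F z) (dzbar F z)

/-- The phase of `g` is constant on `D` in the sense that makes sense also at zeros of `g`:
`g = t e^{iθ}` with a constant `θ` and a real function `t`. -/
def HasConstantPhase (g : ℂ → ℂ) (D : Set ℂ) : Prop :=
  ∃ θ : ℝ, ∀ z ∈ D, ∃ t : ℝ, g z = t * Complex.exp (θ * Complex.I)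

/-! ### Frames and the loop of connections -/

/-- `η = diag(-1, -1, 1, 1)`. -/
def etaMat : Matrix (Fin 4) (Fin 4) ℝ := Matrix.diagonal ![-1, -1, 1, 1]

/-- A smooth frame of `f` over the domain of the coordinate `e`: a smooth map `F` into the
pseudo-orthogonal group `Fᵀ η F = η` of `ℝ⁴₂`, with columns `F₁, …, F₄`, such that
`f = [F₁ + i F₂]`. For instance `F₁ + i F₂ = √2 𝔣` for a horizontal lift `𝔣`, with `F₃`, `F₄`
obtained from `Re 𝔣_z`, `Im 𝔣_z` by the Gram-Schmidt process where these are independent. -/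
structure IsFrame (f : M → ℙ ℂ (Fin 4 → ℂ)) (e : OpenPartialHomeomorph M ℂ)
    (F : ℂ → Matrix (Fin 4) (Fin 4) ℝ) : Prop where
  chart : e ∈ IsManifold.maximalAtlas 𝓘(ℂ) ω M
  smooth : ∀ i j, ContDiffOn ℝ ∞ (fun z => F z i j) e.target
  orthogonal : ∀ z ∈ e.target, (F z)ᵀ * etaMat * F z = etaMat
  lift : ∀ z ∈ e.target, ∃ h : (fun i => (F z i 0 : ℂ) + Complex.I * (F z i 1 : ℂ)) ≠ 0,
    f (e.symm z) =
      Projectivization.mk ℂ (fun i => (F z i 0 : ℂ) + Complex.I * (F z i 1 : ℂ)) h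

end Surface

/-- The frame as a complex matrix. -/
def complexify (F : ℂ → Matrix (Fin 4) (Fin 4) ℝ) (z : ℂ) : Matrix (Fin 4) (Fin 4) ℂ :=
  (F z).map fun x : ℝ => (x : ℂ)

/-- The `dz`-coefficient `U = F⁻¹ F_z` of the Maurer-Cartan form `F⁻¹ dF = U dz + V dz̄`. -/
def mcU (F : ℂ → Matrix (Fin 4) (Fin 4) ℝ) (z : ℂ) : Matrix (Fin 4) (Fin 4) ℂ :=
  (complexify F z)⁻¹ * matDz (complexify F) z

/-- The `dz̄`-coefficient `V = F⁻¹ F_z̄` of the Maurer-Cartan form `F⁻¹ dF = U dz + V dz̄`. -/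
def mcV (F : ℂ → Matrix (Fin 4) (Fin 4) ℝ) (z : ℂ) : Matrix (Fin 4) (Fin 4) ℂ :=
  (complexify F z)⁻¹ * matDzbar (complexify F) z

/-- The involution `σ = Ad diag(1, 1, -1, -1)`. -/
def sigmaInv (A : Matrix (Fin 4) (Fin 4) ℂ) : Matrix (Fin 4) (Fin 4) ℂ :=
  Matrix.diagonal ![1, 1, -1, -1] * A * Matrix.diagonal ![1, 1, -1, -1]

/-- The component in `𝔨`, the `+1`-eigenspace of `σ`. -/
def kPart (A : Matrix (Fin 4) (Fin 4) ℂ) : Matrix (Fin 4) (Fin 4) ℂ :=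
  (1 / 2 : ℂ) • (A + sigmaInv A)

/-- The component in `𝔭`, the `-1`-eigenspace of `σ`. -/
def pPart (A : Matrix (Fin 4) (Fin 4) ℂ) : Matrix (Fin 4) (Fin 4) ℂ :=
  (1 / 2 : ℂ) • (A - sigmaInv A)

/-- The `dz`-coefficient of `ω^λ = λ⁻¹ ω'_𝔭 + ω_𝔨 + λ ω''_𝔭`, where `ω = F⁻¹ dF`. -/
def loopU (F : ℂ → Matrix (Fin 4) (Fin 4) ℝ) (lam z : ℂ) : Matrix (Fin 4) (Fin 4) ℂ :=
  lam⁻¹ • pPart (mcU F z) + kPart (mcU F z)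

/-- The `dz̄`-coefficient of `ω^λ = λ⁻¹ ω'_𝔭 + ω_𝔨 + λ ω''_𝔭`, where `ω = F⁻¹ dF`. -/
def loopV (F : ℂ → Matrix (Fin 4) (Fin 4) ℝ) (lam z : ℂ) : Matrix (Fin 4) (Fin 4) ℂ :=
  kPart (mcV F z) + lam • pPart (mcV F z)

/-- The connection `d + A dz + B dz̄` is flat on `D`: `A_z̄ - B_z = [A, B]`. -/
def IsFlatOn (A B : ℂ → Matrix (Fin 4) (Fin 4) ℂ) (D : Set ℂ) : Prop :=
  ∀ z ∈ D, matDzbar A z - matDz B z = A z * B z - B z * A z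

/-- The connections `d + ω^λ` are flat on `D` for all `λ` in the unit circle. -/
def IsLoopFlatOn (F : ℂ → Matrix (Fin 4) (Fin 4) ℝ) (D : Set ℂ) : Prop :=
  ∀ lam : ℂ, ‖lam‖ = 1 → IsFlatOn (loopU F lam) (loopV F lam) D

end HypQuadric

end

open HypQuadric

noncomputable section

namespace HypQuadric

/-! ### Algebra of the bilinear and the Hermitian form -/

section Algebra

variable (u v w : Fin 4 → ℂ) (c : ℂ)

/-! Each of the three conditions says that one complex function on the surface vanishes.

For a unit lift `F`, `tension F` is the covariant derivative of f_z in the direction z̄, corrected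
for the phase of `F`. Conformality gives the real part, and the Lagrangian condition the imaginary
part, of the fact that the horizontal parts of F_z and F_z̄ are Hermitian-orthogonal of the same
square length ρ. They therefore form a basis of the complex two-dimensional tangent space of the
quadric (`tanProj_expand`), and the tension field is normal to the surface
(`herm_tension_horDzbar`), hence determined by its single component a along F_z. The mean curvature
vector is a positive multiple of it (`meanCurvature_eq`), and its vanishing depends neither on the
coordinate nor on the lift (`tension_eq_zero_of_isLift`).

Frames: by the Maurer-Cartan equation the curvature of d + ω^λ is (λ⁻¹ - λ) times one matrix,
`flatObstruction` (`loop_curvature`). That matrix is real, skew and off-diagonal, so it is known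
from its value on e₁ + i e₂, which is the tension field of the lift (F₁ + i F₂)/√2 written in the
frame (`tension_frameLift`).

Horizontal lifts: the Gram matrix of F_z, F_z̄ for ⟨ , ⟩, with entries α, β, γ, is ρ times a unitary
matrix, whose determinant δ is `phaseFun F`. Then β = -δ β̄, so δ carries the phase of β; moreover d
log δ is made of multiples of a and ā (`dz_phase`, `dzbar_phase`), and α_z̄ = 2(aα - āβ)/ρ
(`dzbar_alpha`). If a = 0, then α is holomorphic and δ is constant. Conversely, constant phase makes
δ locally constant where β ≠ 0, which forces a = 0; where β = 0 one has |α| = ρ, and holomorphy of α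
forces a = 0.

The global statement follows because minimality is local and every point has a neighbourhood with a
frame and one with a horizontal lift. The latter exists because the Lagrangian condition makes the
connection form closed. -/

lemma bil_comm : bil v w = bil w v := by simp only [bil]; ring

lemma bil_add_left : bil (u + v) w = bil u w + bil v w := by simp [bil]; ring

lemma bil_smul_left : bil (c • v) w = c * bil v w := by simp [bil]; ring

lemma bil_smul_right : bil v (c • w) = c * bil v w := by simp [bil]; ring

lemma bil_sub_left : bil (u - v) w = bil u w - bil v w := by simp [bil]; ring

lemma bil_star_star : bil (star v) (star w) = star (bil v w) := by simp [bil]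

lemma herm_add_left : herm (u + v) w = herm u w + herm v w := bil_add_left _ _ _

lemma herm_add_right : herm u (v + w) = herm u v + herm u w := by simp [herm, bil]; ring

lemma herm_sub_left : herm (u - v) w = herm u w - herm v w := by simp [herm, bil]; ring

lemma herm_sub_right : herm u (v - w) = herm u v - herm u w := by simp [herm, bil]; ring

lemma herm_smul_left : herm (c • v) w = c * herm v w := bil_smul_left _ _ _

lemma herm_smul_right : herm v (c • w) = star c * herm v w := by simp [herm, bil]; ring

lemma star_herm : star (herm v w) = herm w v := by simp [herm, bil]; ring

lemma herm_star_right : herm v (star w) = bil v w := by simp [herm]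

lemma herm_star_left : herm (star v) w = star (bil v w) := by
  simp [herm, bil_star_star]

lemma bil_star_left : bil (star v) w = herm w v := by rw [bil_comm]; rfl

lemma herm_star_star : herm (star v) (star w) = herm w v := by
  rw [herm_star_right, herm, bil_comm]

lemma herm_zero_left : herm 0 w = 0 := by simp [herm, bil]

lemma herm_self_im : (herm v v).im = 0 := by
  have := congrArg Complex.im (star_herm v v)
  simp at this
  linarith

lemma herm_self_eq_re : herm v v = ((herm v v).re : ℂ) := by
  apply Complex.ext <;> simp [herm_self_im]

end Algebra

/-- The Hermitian form is positive definite on the orthogonal complement of `w` and `w̄`. -/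
lemma herm_self_re_pos {w v : Fin 4 → ℂ} (hw : herm w w = -1) (hn : bil w w = 0)
    (hv : herm v w = 0) (hv' : bil v w = 0) (hv0 : v ≠ 0) : 0 < (herm v v).re := by
  by_contra! hle
  -- The coefficients are the 2×2 minors of the first two coordinates of w, w̄, v (Cramer's rule),
  -- chosen so that x has its first two coordinates zero. Hence (x, x) ≥ 0, while (v, v) ≤ 0 would
  -- make the expansion of (x, x) nonpositive.
  set c₁ : ℂ := star (w 0) * v 1 - star (w 1) * v 0 with hc₁
  set c₂ : ℂ := v 0 * w 1 - v 1 * w 0 with hc₂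
  set c₃ : ℂ := w 0 * star (w 1) - w 1 * star (w 0) with hc₃
  set x : Fin 4 → ℂ := c₁ • w + c₂ • star w + c₃ • v with hx
  have hx0 : x 0 = 0 := by simp [hx, hc₁, hc₂, hc₃]; ring
  have hx1 : x 1 = 0 := by simp [hx, hc₁, hc₂, hc₃]; ring
  have hwv : herm w v = 0 := by rw [← star_herm, hv, star_zero]
  have h1 : herm x x = -(c₁ * star c₁) - c₂ * star c₂ + c₃ * star c₃ * herm v v := by
    simp only [hx, herm_add_left, herm_add_right, herm_smul_left, herm_smul_right, herm_star_right,
      herm_star_left, bil_add_left, bil_smul_left, bil_star_left, hw, hn, hv, hv', hwv, bil_comm w v,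
      star_zero]
    ring
  have h2 : herm x x = x 2 * star (x 2) + x 3 * star (x 3) := by
    simp [herm, bil, hx0, hx1]
  have hns (z : ℂ) : (z * star z) = ((Complex.normSq z : ℝ) : ℂ) := Complex.mul_conj z
  have h3 : Complex.normSq (x 2) + Complex.normSq (x 3) + Complex.normSq c₁ + Complex.normSq c₂
      = Complex.normSq c₃ * (herm v v).re := by
    have h := h1.symm.trans h2
    rw [herm_self_eq_re v] at h
    simp only [hns] at h
    norm_cast at h
    linarith
  -- If c₃ = 0, then |w₀|² + |w₁|² = |w₀² + w₁²| = |w₂² + w₃²| ≤ |w₂|² + |w₃|², contradicting (w, w)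
  -- = -1.
  have hc3 : c₃ ≠ 0 := by
    intro h0
    have e1 : Complex.normSq c₃ = (Complex.normSq (w 0) + Complex.normSq (w 1)) ^ 2
        - Complex.normSq (w 0 ^ 2 + w 1 ^ 2) := by
      simp [hc₃, Complex.normSq_apply, pow_two]; ring
    have e2 : w 0 ^ 2 + w 1 ^ 2 = w 2 ^ 2 + w 3 ^ 2 := by
      simp only [bil] at hn; linear_combination -hn
    have e3 : Complex.normSq (w 0) + Complex.normSq (w 1)
        = 1 + (Complex.normSq (w 2) + Complex.normSq (w 3)) := by
      have h := hw
      simp only [herm, bil, Pi.star_apply, hns] at h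
      have h' := congrArg Complex.re h
      simp at h'
      linarith
    have e4 : Complex.normSq (w 2 ^ 2 + w 3 ^ 2) ≤
        (Complex.normSq (w 2) + Complex.normSq (w 3)) ^ 2 := by
      simp only [Complex.normSq_apply, pow_two, Complex.add_re, Complex.add_im, Complex.mul_re,
        Complex.mul_im]
      nlinarith [sq_nonneg ((w 2).re * (w 3).im - (w 2).im * (w 3).re)]
    rw [h0, e2, e3, map_zero] at e1
    nlinarith [Complex.normSq_nonneg (w 2), Complex.normSq_nonneg (w 3)]
  have hle' : Complex.normSq c₃ * (herm v v).re ≤ 0 :=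
    mul_nonpos_of_nonneg_of_nonpos (Complex.normSq_nonneg _) hle
  have p1 := Complex.normSq_nonneg (x 2)
  have p2 := Complex.normSq_nonneg (x 3)
  have p3 := Complex.normSq_nonneg c₁
  have p4 := Complex.normSq_nonneg c₂
  have z1 : x 2 = 0 := Complex.normSq_eq_zero.1 (by linarith)
  have z2 : x 3 = 0 := Complex.normSq_eq_zero.1 (by linarith)
  have z3 : c₁ = 0 := Complex.normSq_eq_zero.1 (by linarith)
  have z4 : c₂ = 0 := Complex.normSq_eq_zero.1 (by linarith)
  have hx00 : x = 0 := by
    ext i; fin_cases i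
    exacts [hx0, hx1, z1, z2]
  rw [hx00, z3, z4] at hx
  simp only [zero_smul, zero_add] at hx
  exact hv0 ((smul_eq_zero.1 hx.symm).resolve_left hc3)

/-- A vector orthogonal to four vectors with a nondegenerate diagonal Gram matrix is zero. -/
lemma eq_zero_of_herm_eq_zero {b : Fin 4 → Fin 4 → ℂ} {d : Fin 4 → ℂ} (hd : ∀ i, d i ≠ 0)
    (hb : ∀ i j, herm (b j) (b i) = Matrix.diagonal d i j) {y : Fin 4 → ℂ}
    (hy : ∀ i, herm y (b i) = 0) : y = 0 := by
  set A : Matrix (Fin 4) (Fin 4) ℂ :=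
    Matrix.of fun i j => ![-1, -1, 1, 1] j * star (b i j) with hA
  have key (v : Fin 4 → ℂ) (i : Fin 4) : (A *ᵥ v) i = herm v (b i) := by
    simp [hA, Matrix.mulVec, dotProduct, Fin.sum_univ_four, herm, bil]; ring
  -- The functionals (·, bᵢ), evaluated on the vectors bⱼ, give the Gram matrix; its invertibility
  -- makes the matrix of functionals invertible.
  have hAB : A * Matrix.of (fun i j => b j i) = Matrix.diagonal d := by
    ext i j
    rw [← hb i j, ← key (b j) i]
    rfl
  have hdet : A.det ≠ 0 := by
    intro h0
    have := congrArg Matrix.det hAB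
    rw [Matrix.det_mul, h0, zero_mul, Matrix.det_diagonal] at this
    exact Finset.prod_ne_zero_iff.2 (fun i _ => hd i) this.symm
  refine Matrix.eq_zero_of_mulVec_eq_zero hdet ?_
  ext i
  rw [key, hy i]; rfl

lemma herm_tanProj_left {w v a : Fin 4 → ℂ} (ha : herm a w = 0) (ha' : bil a w = 0) :
    herm (tanProj w v) a = herm v a := by
  have h1 : herm w a = 0 := by rw [← star_herm, ha, star_zero]
  have h2 : herm (star w) a = 0 := by rw [herm_star_left, bil_comm, ha', star_zero]
  simp [tanProj, herm_add_left, herm_smul_left, h1, h2]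

lemma herm_tanProj_self {w v : Fin 4 → ℂ} (hw : herm w w = -1) (hn : bil w w = 0) :
    herm (tanProj w v) w = 0 := by
  simp [tanProj, herm_add_left, herm_smul_left, hw, herm_star_left, hn]

lemma bil_tanProj_self {w v : Fin 4 → ℂ} (hw : herm w w = -1) (hn : bil w w = 0) :
    bil (tanProj w v) w = 0 := by
  simp [tanProj, bil_add_left, bil_smul_left, hn, bil_star_left, hw, herm_star_right]

/-- Expansion of the tangential part in an orthogonal basis of the tangent space. -/
lemma tanProj_eq {w a b : Fin 4 → ℂ} {r : ℂ} (v : Fin 4 → ℂ) (hr : r ≠ 0) (hw : herm w w = -1)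
    (hn : bil w w = 0) (ha : herm a w = 0) (ha' : bil a w = 0) (hb : herm b w = 0)
    (hb' : bil b w = 0) (haa : herm a a = r) (hbb : herm b b = r) (hab : herm a b = 0) :
    tanProj w v = (herm v a / r) • a + (herm v b / r) • b := by
  rw [← sub_eq_zero]
  have hba : herm b a = 0 := by rw [← star_herm, hab, star_zero]
  have hwa : herm w a = 0 := by rw [← star_herm, ha, star_zero]
  have hwb : herm w b = 0 := by rw [← star_herm, hb, star_zero]
  have hwa' : bil w a = 0 := by rw [bil_comm, ha']
  have hwb' : bil w b = 0 := by rw [bil_comm, hb']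
  -- The difference of the two sides is tested against w, w̄, a, b, whose Gram matrix is diag(-1,
  -- -1, r, r).
  refine eq_zero_of_herm_eq_zero (b := ![w, star w, a, b]) (d := ![-1, -1, r, r]) ?_ ?_ ?_
  · intro i; fin_cases i <;> simp [hr]
  · intro i j
    fin_cases i <;> fin_cases j <;>
      simp [hw, hn, ha, ha', hb, hb', haa, hbb, hab, hba, hwa, hwb, hwa', hwb', herm_star_left,
        herm_star_right]
    rw [← herm_star_right, herm_star_star, hw]
  · intro i
    fin_cases i
    · simp [herm_sub_left, herm_add_left, herm_smul_left, herm_tanProj_self hw hn, ha, hb]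
    · simp [bil_sub_left, bil_add_left, bil_smul_left, herm_star_right,
        bil_tanProj_self hw hn, ha', hb']
    · simp [herm_sub_left, herm_add_left, herm_smul_left, herm_tanProj_left ha ha', haa, hba, hr]
    · simp [herm_sub_left, herm_add_left, herm_smul_left, herm_tanProj_left hb hb', hbb, hab, hr]

lemma tanProj_add (w u v : Fin 4 → ℂ) : tanProj w (u + v) = tanProj w u + tanProj w v := by
  simp only [tanProj, herm_add_left, add_smul]; abel

lemma tanProj_smul (w v : Fin 4 → ℂ) (c : ℂ) : tanProj w (c • v) = c • tanProj w v := by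
  simp only [tanProj, herm_smul_left, smul_add, smul_smul]

lemma tanProj_base {w : Fin 4 → ℂ} (hw : herm w w = -1) (hn : bil w w = 0) :
    tanProj w w = 0 := by
  simp [tanProj, hw, hn, herm_star_right]

/-- The tangential projection does not depend on the unit representative. -/
lemma tanProj_smul_base (w v : Fin 4 → ℂ) {c : ℂ} (hc : c * star c = 1) :
    tanProj (c • w) v = tanProj w v := by
  have hc' : star c * c = 1 := by rw [mul_comm, hc]
  have : star (c • w) = star c • star w := by ext; simp
  simp only [tanProj, herm_smul_right, this, smul_smul]
  rw [mul_right_comm, hc', mul_right_comm, star_star, hc, one_mul, one_mul]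

/-! ### Calculus of `∂_z` and `∂_z̄` -/

section Calculus

variable {E : Type*} [NormedAddCommGroup E] [NormedSpace ℂ E]

lemma fderiv_eq_dz_add_dzbar (g : ℂ → E) (z X : ℂ) :
    fderiv ℝ g z X = X • dz g z + star X • dzbar g z := by
  have hX : fderiv ℝ g z X = (X.re : ℂ) • fderiv ℝ g z 1 + (X.im : ℂ) • fderiv ℝ g z Complex.I := by
    conv_lhs => rw [show X = X.re • (1 : ℂ) + X.im • Complex.I by
      apply Complex.ext <;> simp]
    rw [map_add, map_smul, map_smul]
    simp
  have hXX : X = X.re + X.im * Complex.I := (Complex.re_add_im X).symm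
  have hXs : star X = X.re - X.im * Complex.I := by apply Complex.ext <;> simp
  rw [hX, dz, dzbar, hXs]
  nth_rw 3 [hXX]
  simp only [smul_sub, smul_add, smul_smul]
  have hI : Complex.I * Complex.I = -1 := Complex.I_mul_I
  match_scalars
  · ring
  · linear_combination (X.im : ℂ) * hI

lemma fderiv_one (g : ℂ → E) (z : ℂ) : fderiv ℝ g z 1 = dz g z + dzbar g z := by
  rw [fderiv_eq_dz_add_dzbar]; simp

lemma fderiv_I (g : ℂ → E) (z : ℂ) :
    fderiv ℝ g z Complex.I = Complex.I • (dz g z - dzbar g z) := by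
  rw [fderiv_eq_dz_add_dzbar]; simp [smul_sub]; module

lemma dz_congr {f g : ℂ → E} {z : ℂ} (h : f =ᶠ[nhds z] g) : dz f z = dz g z := by
  simp [dz, h.fderiv_eq]

lemma dzbar_congr {f g : ℂ → E} {z : ℂ} (h : f =ᶠ[nhds z] g) : dzbar f z = dzbar g z := by
  simp [dzbar, h.fderiv_eq]

lemma eventuallyEq_dz {f g : ℂ → E} {z : ℂ} (h : f =ᶠ[nhds z] g) : dz f =ᶠ[nhds z] dz g := by
  filter_upwards [h.eventuallyEq_nhds] with x hx using dz_congr hx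

lemma dz_const (c : E) (z : ℂ) : dz (fun _ => c) z = 0 := by simp [dz]

lemma dzbar_const (c : E) (z : ℂ) : dzbar (fun _ => c) z = 0 := by simp [dzbar]

lemma dz_add {f g : ℂ → E} {z : ℂ} (hf : DifferentiableAt ℝ f z) (hg : DifferentiableAt ℝ g z) :
    dz (fun w => f w + g w) z = dz f z + dz g z := by
  simp only [dz, fderiv_fun_add hf hg, add_apply]; module

lemma dzbar_add {f g : ℂ → E} {z : ℂ} (hf : DifferentiableAt ℝ f z)
    (hg : DifferentiableAt ℝ g z) :
    dzbar (fun w => f w + g w) z = dzbar f z + dzbar g z := by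
  simp only [dzbar, fderiv_fun_add hf hg, add_apply]; module

lemma dz_sub {f g : ℂ → E} {z : ℂ} (hf : DifferentiableAt ℝ f z) (hg : DifferentiableAt ℝ g z) :
    dz (fun w => f w - g w) z = dz f z - dz g z := by
  simp only [dz, fderiv_fun_sub hf hg, sub_apply]; module

lemma dzbar_sub {f g : ℂ → E} {z : ℂ} (hf : DifferentiableAt ℝ f z)
    (hg : DifferentiableAt ℝ g z) :
    dzbar (fun w => f w - g w) z = dzbar f z - dzbar g z := by
  simp only [dzbar, fderiv_fun_sub hf hg, sub_apply]; module

lemma dz_smul {c : ℂ → ℂ} {f : ℂ → E} {z : ℂ} (hc : DifferentiableAt ℝ c z)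
    (hf : DifferentiableAt ℝ f z) :
    dz (fun w => c w • f w) z = dz c z • f z + c z • dz f z := by
  simp only [dz, fderiv_fun_smul hc hf, add_apply,
    smul_apply, ContinuousLinearMap.smulRight_apply, smul_eq_mul]; module

lemma dzbar_smul {c : ℂ → ℂ} {f : ℂ → E} {z : ℂ} (hc : DifferentiableAt ℝ c z)
    (hf : DifferentiableAt ℝ f z) :
    dzbar (fun w => c w • f w) z = dzbar c z • f z + c z • dzbar f z := by
  simp only [dzbar, fderiv_fun_smul hc hf, add_apply,
    smul_apply, ContinuousLinearMap.smulRight_apply, smul_eq_mul]; module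

lemma dz_mul {f g : ℂ → ℂ} {z : ℂ} (hf : DifferentiableAt ℝ f z) (hg : DifferentiableAt ℝ g z) :
    dz (fun w => f w * g w) z = dz f z * g z + f z * dz g z := dz_smul hf hg

lemma dzbar_mul {f g : ℂ → ℂ} {z : ℂ} (hf : DifferentiableAt ℝ f z)
    (hg : DifferentiableAt ℝ g z) :
    dzbar (fun w => f w * g w) z = dzbar f z * g z + f z * dzbar g z := dzbar_smul hf hg

lemma dz_neg (f : ℂ → E) (z : ℂ) : dz (fun w => -f w) z = -dz f z := by
  simp only [dz, fderiv_fun_neg, neg_apply]; module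

lemma dzbar_neg (f : ℂ → E) (z : ℂ) : dzbar (fun w => -f w) z = -dzbar f z := by
  simp only [dzbar, fderiv_fun_neg, neg_apply]; module

lemma dz_apply {ι : Type*} [Fintype ι] {f : ℂ → ι → ℂ} {z : ℂ} (hf : DifferentiableAt ℝ f z)
    (i : ι) : dz (fun w => f w i) z = dz f z i := by
  simp [dz, fderiv_apply hf]

lemma dzbar_apply {ι : Type*} [Fintype ι] {f : ℂ → ι → ℂ} {z : ℂ} (hf : DifferentiableAt ℝ f z)
    (i : ι) : dzbar (fun w => f w i) z = dzbar f z i := by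
  simp [dzbar, fderiv_apply hf]

lemma dz_star [StarAddMonoid E] [StarModule ℂ E] [ContinuousStar E] (f : ℂ → E) (z : ℂ) :
    dz (fun w => star (f w)) z = star (dzbar f z) := by
  have : StarModule ℝ E := ⟨fun r x => by
    rw [← Complex.coe_smul, star_smul, ← Complex.coe_smul]; simp⟩
  simp only [dz, dzbar, fderiv_star, ContinuousLinearMap.comp_apply]
  simp [star_smul, sub_eq_add_neg]

lemma dzbar_star [StarAddMonoid E] [StarModule ℂ E] [ContinuousStar E] (f : ℂ → E) (z : ℂ) :
    dzbar (fun w => star (f w)) z = star (dz f z) := by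
  have : StarModule ℝ E := ⟨fun r x => by
    rw [← Complex.coe_smul, star_smul, ← Complex.coe_smul]; simp⟩
  simp only [dz, dzbar, fderiv_star, ContinuousLinearMap.comp_apply]
  simp [star_smul, sub_eq_add_neg]

lemma dz_bil {f g : ℂ → Fin 4 → ℂ} {z : ℂ} (hf : DifferentiableAt ℝ f z)
    (hg : DifferentiableAt ℝ g z) :
    dz (fun w => bil (f w) (g w)) z = bil (dz f z) (g z) + bil (f z) (dz g z) := by
  have hf' (i) : DifferentiableAt ℝ (fun w => f w i) z := by fun_prop
  have hg' (i) : DifferentiableAt ℝ (fun w => g w i) z := by fun_prop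
  have hfg (i) : DifferentiableAt ℝ (fun w => f w i * g w i) z := by fun_prop
  have hn : DifferentiableAt ℝ (fun w => -(f w 0 * g w 0)) z := by fun_prop
  simp only [bil]
  rw [dz_add (by fun_prop) (hfg 3), dz_add (by fun_prop) (hfg 2), dz_sub hn (hfg 1), dz_neg]
  simp only [dz_mul (hf' _) (hg' _), dz_apply hf, dz_apply hg]
  ring

lemma dzbar_bil {f g : ℂ → Fin 4 → ℂ} {z : ℂ} (hf : DifferentiableAt ℝ f z)
    (hg : DifferentiableAt ℝ g z) :
    dzbar (fun w => bil (f w) (g w)) z = bil (dzbar f z) (g z) + bil (f z) (dzbar g z) := by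
  have hf' (i) : DifferentiableAt ℝ (fun w => f w i) z := by fun_prop
  have hg' (i) : DifferentiableAt ℝ (fun w => g w i) z := by fun_prop
  have hfg (i) : DifferentiableAt ℝ (fun w => f w i * g w i) z := by fun_prop
  have hn : DifferentiableAt ℝ (fun w => -(f w 0 * g w 0)) z := by fun_prop
  simp only [bil]
  rw [dzbar_add (by fun_prop) (hfg 3), dzbar_add (by fun_prop) (hfg 2), dzbar_sub hn (hfg 1),
    dzbar_neg]
  simp only [dzbar_mul (hf' _) (hg' _), dzbar_apply hf, dzbar_apply hg]
  ring

lemma dz_herm {f g : ℂ → Fin 4 → ℂ} {z : ℂ} (hf : DifferentiableAt ℝ f z)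
    (hg : DifferentiableAt ℝ g z) :
    dz (fun w => herm (f w) (g w)) z = herm (dz f z) (g z) + herm (f z) (dzbar g z) := by
  simp only [herm]
  rw [dz_bil hf hg.star, dz_star]

lemma dzbar_herm {f g : ℂ → Fin 4 → ℂ} {z : ℂ} (hf : DifferentiableAt ℝ f z)
    (hg : DifferentiableAt ℝ g z) :
    dzbar (fun w => herm (f w) (g w)) z = herm (dzbar f z) (g z) + herm (f z) (dz g z) := by
  simp only [herm]
  rw [dzbar_bil hf hg.star, dzbar_star]

lemma contDiffAt_fderiv {f : ℂ → E} {z : ℂ} (hf : ContDiffAt ℝ ∞ f z) :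
    ContDiffAt ℝ ∞ (fderiv ℝ f) z := hf.fderiv_right (by simp)

lemma contDiffAt_dz {f : ℂ → E} {z : ℂ} (hf : ContDiffAt ℝ ∞ f z) : ContDiffAt ℝ ∞ (dz f) z := by
  have h := contDiffAt_fderiv hf
  unfold dz
  fun_prop

lemma contDiffAt_dzbar {f : ℂ → E} {z : ℂ} (hf : ContDiffAt ℝ ∞ f z) :
    ContDiffAt ℝ ∞ (dzbar f) z := by
  have h := contDiffAt_fderiv hf
  unfold dzbar
  fun_prop

lemma ContDiffAt.diffAt {f : ℂ → E} {z : ℂ} (hf : ContDiffAt ℝ ∞ f z) : DifferentiableAt ℝ f z :=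
  hf.differentiableAt (by simp)

lemma contDiffAt_bil {f g : ℂ → Fin 4 → ℂ} {z : ℂ} (hf : ContDiffAt ℝ ∞ f z)
    (hg : ContDiffAt ℝ ∞ g z) : ContDiffAt ℝ ∞ (fun w => bil (f w) (g w)) z := by
  unfold bil
  have hf' (i) : ContDiffAt ℝ ∞ (fun w => f w i) z := contDiffAt_pi.1 hf i
  have hg' (i) : ContDiffAt ℝ ∞ (fun w => g w i) z := contDiffAt_pi.1 hg i
  exact ((((hf' 0).mul (hg' 0)).neg.sub ((hf' 1).mul (hg' 1))).add ((hf' 2).mul (hg' 2))).add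
    ((hf' 3).mul (hg' 3))

lemma contDiffAt_star {f : ℂ → E} [StarAddMonoid E] [StarModule ℂ E] [ContinuousStar E]
    {z : ℂ} (hf : ContDiffAt ℝ ∞ f z) : ContDiffAt ℝ ∞ (fun w => star (f w)) z := by
  have : StarModule ℝ E := ⟨fun r x => by
    rw [← Complex.coe_smul, star_smul, ← Complex.coe_smul]; simp⟩
  exact (starL' ℝ : E ≃L[ℝ] E).contDiff.contDiffAt.comp z hf

lemma contDiffAt_herm {f g : ℂ → Fin 4 → ℂ} {z : ℂ} (hf : ContDiffAt ℝ ∞ f z)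
    (hg : ContDiffAt ℝ ∞ g z) : ContDiffAt ℝ ∞ (fun w => herm (f w) (g w)) z :=
  contDiffAt_bil hf (contDiffAt_star hg)

lemma dzbar_dz {f : ℂ → E} {z : ℂ} (hf : ContDiffAt ℝ ∞ f z) :
    dz (dzbar f) z = dzbar (dz f) z := by
  have hs : IsSymmSndFDerivAt ℝ f z :=
    hf.isSymmSndFDerivAt (by simp; exact WithTop.coe_le_coe.2 (le_top : (2 : ℕ∞) ≤ ⊤))
  have hd : DifferentiableAt ℝ (fderiv ℝ f) z := ContDiffAt.diffAt (contDiffAt_fderiv hf)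
  have h (Y X : ℂ) : fderiv ℝ (fun w => fderiv ℝ f w Y) z X = fderiv ℝ (fderiv ℝ f) z X Y := by
    rw [fderiv_clm_apply hd (by fun_prop)]; simp
  have hd' (Y : ℂ) : DifferentiableAt ℝ (fun w => fderiv ℝ f w Y) z := by fun_prop
  have hd1 : fderiv ℝ (dz f) z = (1 / 2 : ℂ) • (fderiv ℝ (fun w => fderiv ℝ f w 1) z
      - Complex.I • fderiv ℝ (fun w => fderiv ℝ f w Complex.I) z) := by
    unfold dz
    rw [fderiv_fun_const_smul (by fun_prop), fderiv_fun_sub (by fun_prop) (by fun_prop),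
      fderiv_fun_const_smul (by fun_prop)]
  have hd2 : fderiv ℝ (dzbar f) z = (1 / 2 : ℂ) • (fderiv ℝ (fun w => fderiv ℝ f w 1) z
      + Complex.I • fderiv ℝ (fun w => fderiv ℝ f w Complex.I) z) := by
    unfold dzbar
    rw [fderiv_fun_const_smul (by fun_prop), fderiv_fun_add (by fun_prop) (by fun_prop),
      fderiv_fun_const_smul (by fun_prop)]
  rw [dz, dzbar, hd1, hd2]
  simp only [smul_apply, add_apply,
    sub_apply, h]
  rw [hs Complex.I 1]
  module

end Calculus

/-! ### Conformal Lagrangian lifts over plane domains -/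

/-- A smooth unit lift over an open set of a conformal Lagrangian immersion into the quadric. -/
structure IsLagrangianLift (F : ℂ → Fin 4 → ℂ) (D : Set ℂ) : Prop where
  isOpen : IsOpen D
  smooth : ContDiffOn ℝ ∞ F D
  unit : ∀ z ∈ D, herm (F z) (F z) = -1
  null : ∀ z ∈ D, bil (F z) (F z) = 0
  immersion : ∀ z ∈ D, ∀ X : ℂ, diffMap F X z = 0 → X = 0
  conformal : ∀ z ∈ D, (inducedForm F z 1 1).re = (inducedForm F z Complex.I Complex.I).re ∧
      (inducedForm F z 1 Complex.I).re = 0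
  lagrangian : ∀ z ∈ D, ∀ X Y : ℂ, (inducedForm F z X Y).im = 0

/-- The horizontal part of `F_z`. -/
def horDz (F : ℂ → Fin 4 → ℂ) (z : ℂ) : Fin 4 → ℂ := hor (F z) (dz F z)

/-- The horizontal part of `F_z̄`. -/
def horDzbar (F : ℂ → Fin 4 → ℂ) (z : ℂ) : Fin 4 → ℂ := hor (F z) (dzbar F z)

/-- The complexified tension field `∇_z̄ ∂_z f` of `[F]`. -/
def tension (F : ℂ → Fin 4 → ℂ) (z : ℂ) : Fin 4 → ℂ :=
  tanProj (F z) (dzbar (dz F) z + herm (dzbar F z) (F z) • dz F z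
    + herm (dz F z) (F z) • dzbar F z)

lemma hor_add (w u v : Fin 4 → ℂ) : hor w (u + v) = hor w u + hor w v := by
  simp only [hor, herm_add_left]; module

lemma hor_sub (w u v : Fin 4 → ℂ) : hor w (u - v) = hor w u - hor w v := by
  simp only [hor, herm_sub_left]; module

lemma hor_smul (w v : Fin 4 → ℂ) (c : ℂ) : hor w (c • v) = c • hor w v := by
  simp only [hor, herm_smul_left]; module

lemma diffMap_one (F : ℂ → Fin 4 → ℂ) (z : ℂ) : diffMap F 1 z = horDz F z + horDzbar F z := by
  rw [diffMap, fderiv_one, hor_add]; rfl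

lemma diffMap_I (F : ℂ → Fin 4 → ℂ) (z : ℂ) :
    diffMap F Complex.I z = Complex.I • (horDz F z - horDzbar F z) := by
  rw [diffMap, fderiv_I, hor_smul, hor_sub]; rfl

lemma horDz_eq (F : ℂ → Fin 4 → ℂ) (z : ℂ) :
    horDz F z = (1 / 2 : ℂ) • (diffMap F 1 z - Complex.I • diffMap F Complex.I z) := by
  rw [diffMap_one, diffMap_I, smul_smul, Complex.I_mul_I]; module

lemma horDzbar_eq (F : ℂ → Fin 4 → ℂ) (z : ℂ) :
    horDzbar F z = (1 / 2 : ℂ) • (diffMap F 1 z + Complex.I • diffMap F Complex.I z) := by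
  rw [diffMap_one, diffMap_I, smul_smul, Complex.I_mul_I]; module

lemma herm_hor {w v : Fin 4 → ℂ} (hw : herm w w = -1) : herm (hor w v) w = 0 := by
  simp [hor, herm_add_left, herm_smul_left, hw]

lemma normalPart_add (F : ℂ → Fin 4 → ℂ) (z : ℂ) (u v : Fin 4 → ℂ) :
    normalPart F z (u + v) = normalPart F z u + normalPart F z v := by
  simp only [normalPart, herm_add_left, Complex.add_re, add_div, Complex.ofReal_add]; module

namespace IsLagrangianLift

variable {F : ℂ → Fin 4 → ℂ} {D : Set ℂ} {z : ℂ} (h : IsLagrangianLift F D)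
include h

lemma contDiffAt (hz : z ∈ D) : ContDiffAt ℝ ∞ F z :=
  h.smooth.contDiffAt (h.isOpen.mem_nhds hz)

lemma eventually_mem (hz : z ∈ D) : ∀ᶠ w in nhds z, w ∈ D := h.isOpen.mem_nhds hz

lemma differentiableAt (hz : z ∈ D) : DifferentiableAt ℝ F z := (h.contDiffAt hz).diffAt

lemma bil_dz (hz : z ∈ D) : bil (dz F z) (F z) = 0 := by
  have h1 : (fun w => bil (F w) (F w)) =ᶠ[nhds z] fun _ => 0 := by
    filter_upwards [h.eventually_mem hz] with w hw using h.null w hw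
  have h2 := dz_congr h1
  rw [HypQuadric.dz_bil (h.differentiableAt hz) (h.differentiableAt hz), dz_const,
    bil_comm (F z)] at h2
  linear_combination h2 / 2

lemma bil_dzbar (hz : z ∈ D) : bil (dzbar F z) (F z) = 0 := by
  have h1 : (fun w => bil (F w) (F w)) =ᶠ[nhds z] fun _ => 0 := by
    filter_upwards [h.eventually_mem hz] with w hw using h.null w hw
  have h2 := dzbar_congr h1
  rw [HypQuadric.dzbar_bil (h.differentiableAt hz) (h.differentiableAt hz), dzbar_const,
    bil_comm (F z)] at h2
  linear_combination h2 / 2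

lemma herm_horDz (hz : z ∈ D) : herm (horDz F z) (F z) = 0 := herm_hor (h.unit z hz)

lemma herm_horDzbar (hz : z ∈ D) : herm (horDzbar F z) (F z) = 0 := herm_hor (h.unit z hz)

lemma bil_horDz (hz : z ∈ D) : bil (horDz F z) (F z) = 0 := by
  simp [horDz, hor, bil_add_left, bil_smul_left, h.bil_dz hz, h.null z hz]

lemma bil_horDzbar (hz : z ∈ D) : bil (horDzbar F z) (F z) = 0 := by
  simp [horDzbar, hor, bil_add_left, bil_smul_left, h.bil_dzbar hz, h.null z hz]

/-- Conformality controls the real part and the Lagrangian condition the imaginary part; this is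
where the two combine. -/
lemma herm_one_I (hz : z ∈ D) : herm (diffMap F 1 z) (diffMap F Complex.I z) = 0 :=
  Complex.ext (h.conformal z hz).2 (h.lagrangian z hz 1 Complex.I)

lemma herm_I_one (hz : z ∈ D) : herm (diffMap F Complex.I z) (diffMap F 1 z) = 0 := by
  rw [← star_herm, h.herm_one_I hz, star_zero]

lemma herm_I_I (hz : z ∈ D) : herm (diffMap F Complex.I z) (diffMap F Complex.I z)
    = herm (diffMap F 1 z) (diffMap F 1 z) :=
  Complex.ext (h.conformal z hz).1.symm (by simp [herm_self_im])

lemma herm_horDz_horDzbar (hz : z ∈ D) : herm (horDz F z) (horDzbar F z) = 0 := by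
  simp only [horDz_eq, horDzbar_eq, herm_smul_left, herm_smul_right, herm_add_right,
    herm_sub_left, h.herm_one_I hz, h.herm_I_one hz, h.herm_I_I hz]
  simp
  linear_combination ((1 / 2) * herm (diffMap F 1 z) (diffMap F 1 z)) * Complex.I_mul_I

lemma herm_horDz_self (hz : z ∈ D) :
    herm (horDz F z) (horDz F z) = (1 / 2 : ℂ) * herm (diffMap F 1 z) (diffMap F 1 z) := by
  simp only [horDz_eq, herm_smul_left, herm_smul_right, herm_sub_right,
    herm_sub_left, h.herm_one_I hz, h.herm_I_one hz, h.herm_I_I hz]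
  simp
  linear_combination (-(1 / 2) * herm (diffMap F 1 z) (diffMap F 1 z)) * Complex.I_mul_I

lemma herm_horDzbar_self (hz : z ∈ D) :
    herm (horDzbar F z) (horDzbar F z) = herm (horDz F z) (horDz F z) := by
  rw [h.herm_horDz_self hz]
  simp only [horDzbar_eq, herm_smul_left, herm_smul_right, herm_add_right,
    herm_add_left, h.herm_one_I hz, h.herm_I_one hz, h.herm_I_I hz]
  simp
  linear_combination (-(1 / 2) * herm (diffMap F 1 z) (diffMap F 1 z)) * Complex.I_mul_I

lemma inducedForm_pos (hz : z ∈ D) : 0 < (inducedForm F z 1 1).re := by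
  refine herm_self_re_pos (h.unit z hz) (h.null z hz) ?_ ?_ ?_
  · rw [diffMap_one, herm_add_left, h.herm_horDz hz, h.herm_horDzbar hz, add_zero]
  · rw [diffMap_one, bil_add_left, h.bil_horDz hz, h.bil_horDzbar hz, add_zero]
  · intro h0
    exact one_ne_zero (h.immersion z hz 1 h0)

lemma herm_horDz_ne_zero (hz : z ∈ D) : herm (horDz F z) (horDz F z) ≠ 0 := by
  rw [h.herm_horDz_self hz, herm_self_eq_re]
  exact mul_ne_zero (by norm_num) (Complex.ofReal_ne_zero.2 (h.inducedForm_pos hz).ne')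

/-- Expansion of a tangential projection in the basis given by `F_z` and `F_z̄`. -/
lemma tanProj_expand (hz : z ∈ D) (v : Fin 4 → ℂ) :
    tanProj (F z) v =
      (herm v (horDz F z) / herm (horDz F z) (horDz F z)) • horDz F z
      + (herm v (horDzbar F z) / herm (horDz F z) (horDz F z)) • horDzbar F z :=
  tanProj_eq v (h.herm_horDz_ne_zero hz) (h.unit z hz) (h.null z hz) (h.herm_horDz hz)
    (h.bil_horDz hz) (h.herm_horDzbar hz) (h.bil_horDzbar hz) rfl (h.herm_horDzbar_self hz)
    (h.herm_horDz_horDzbar hz)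

lemma contDiffAt_herm_dz (hz : z ∈ D) : ContDiffAt ℝ ∞ (fun w => herm (dz F w) (F w)) z :=
  contDiffAt_herm (contDiffAt_dz (h.contDiffAt hz)) (h.contDiffAt hz)

lemma contDiffAt_herm_dzbar (hz : z ∈ D) :
    ContDiffAt ℝ ∞ (fun w => herm (dzbar F w) (F w)) z :=
  contDiffAt_herm (contDiffAt_dzbar (h.contDiffAt hz)) (h.contDiffAt hz)

lemma contDiffAt_horDz (hz : z ∈ D) : ContDiffAt ℝ ∞ (horDz F) z :=
  (contDiffAt_dz (h.contDiffAt hz)).add ((h.contDiffAt_herm_dz hz).smul (h.contDiffAt hz))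

lemma contDiffAt_horDzbar (hz : z ∈ D) : ContDiffAt ℝ ∞ (horDzbar F) z :=
  (contDiffAt_dzbar (h.contDiffAt hz)).add ((h.contDiffAt_herm_dzbar hz).smul (h.contDiffAt hz))

lemma dzbar_horDz (hz : z ∈ D) : dzbar (horDz F) z = dzbar (dz F) z
    + (dzbar (fun w => herm (dz F w) (F w)) z • F z + herm (dz F z) (F z) • dzbar F z) := by
  have := dzbar_smul (h.contDiffAt_herm_dz hz).diffAt (h.differentiableAt hz)
  have hd : DifferentiableAt ℝ (fun w => herm (dz F w) (F w) • F w) z :=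
    (h.contDiffAt_herm_dz hz).diffAt.smul (h.differentiableAt hz)
  unfold horDz hor
  rw [dzbar_add (contDiffAt_dz (h.contDiffAt hz)).diffAt hd, this]

lemma dz_horDzbar (hz : z ∈ D) : dz (horDzbar F) z = dzbar (dz F) z
    + (dz (fun w => herm (dzbar F w) (F w)) z • F z + herm (dzbar F z) (F z) • dz F z) := by
  have := dz_smul (h.contDiffAt_herm_dzbar hz).diffAt (h.differentiableAt hz)
  have hd : DifferentiableAt ℝ (fun w => herm (dzbar F w) (F w) • F w) z :=
    (h.contDiffAt_herm_dzbar hz).diffAt.smul (h.differentiableAt hz)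
  unfold horDzbar hor
  rw [dz_add (contDiffAt_dzbar (h.contDiffAt hz)).diffAt hd, this,
    dzbar_dz (h.contDiffAt hz)]

/-- The multiples of F created by differentiating the horizontal projection are killed by `tanProj`.
Together with `tension_eq_horDzbar` this expresses the symmetry of the covariant derivatives of f_z
and f_z̄. -/
lemma tension_eq_horDz (hz : z ∈ D) : tension F z =
    tanProj (F z) (dzbar (horDz F) z + herm (dzbar F z) (F z) • horDz F z) := by
  simp only [h.dzbar_horDz hz, tension, horDz, hor, tanProj_add, tanProj_smul,
    tanProj_base (h.unit z hz) (h.null z hz)]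
  module

lemma tension_eq_horDzbar (hz : z ∈ D) : tension F z =
    tanProj (F z) (dz (horDzbar F) z + herm (dz F z) (F z) • horDzbar F z) := by
  simp only [h.dz_horDzbar hz, tension, horDzbar, hor, tanProj_add, tanProj_smul,
    tanProj_base (h.unit z hz) (h.null z hz)]
  module

/-- As the identity of a Riemann surface is harmonic, the tension field is normal. -/
lemma herm_tension_horDzbar (hz : z ∈ D) :
    herm (tension F z) (horDzbar F z) = -star (herm (tension F z) (horDz F z)) := by
  -- Differentiating this orthogonality by z̄ pairs the derivative of the first factor with F_z̄ and
  -- that of the second with F_z. The two expressions of the tension field turn the result into the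
  -- claim, the phase terms dropping out by orthogonality.
  have h1 : (fun w => herm (horDz F w) (horDzbar F w)) =ᶠ[nhds z] fun _ => 0 := by
    filter_upwards [h.eventually_mem hz] with w hw using h.herm_horDz_horDzbar hw
  have h2 := dzbar_congr h1
  rw [dzbar_herm (h.contDiffAt_horDz hz).diffAt (h.contDiffAt_horDzbar hz).diffAt,
    dzbar_const] at h2
  rw [star_herm]
  nth_rw 1 [h.tension_eq_horDz hz]
  rw [herm_tanProj_left (h.herm_horDzbar hz) (h.bil_horDzbar hz), h.tension_eq_horDzbar hz,
    ← star_herm (tanProj _ _), herm_tanProj_left (h.herm_horDz hz) (h.bil_horDz hz), star_herm,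
    herm_add_left,
    herm_add_right, herm_smul_left, herm_smul_right, h.herm_horDz_horDzbar hz]
  linear_combination h2

/-- Normality ties the two complex components together, so that a single complex equation decides
whether the tension field vanishes. -/
lemma tension_expand (hz : z ∈ D) :
    tension F z =
      (herm (tension F z) (horDz F z) / herm (horDz F z) (horDz F z)) • horDz F z
      + (-star (herm (tension F z) (horDz F z)) / herm (horDz F z) (horDz F z)) •
        horDzbar F z := by
  have h1 := h.tanProj_expand hz (tension F z)
  rw [h.herm_tension_horDzbar hz] at h1
  rw [← h1, h.tanProj_expand hz]
  unfold tension
  rw [herm_tanProj_left (h.herm_horDz hz) (h.bil_horDz hz),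
    herm_tanProj_left (h.herm_horDzbar hz) (h.bil_horDzbar hz), ← h.tanProj_expand hz]

lemma tension_eq_zero_iff (hz : z ∈ D) :
    tension F z = 0 ↔ herm (tension F z) (horDz F z) = 0 := by
  constructor
  · intro h0; rw [h0, herm_zero_left]
  · intro h0
    rw [h.tension_expand hz, h0]
    simp

/-- If a and -ā are the components along f_z and f_z̄, those along f_x and f_y are a - ā and -i(a +
ā), both purely imaginary, so the real projection subtracts nothing. -/
lemma normalPart_tension (hz : z ∈ D) (r : ℝ) :
    normalPart F z ((r : ℂ) • tension F z) = (r : ℂ) • tension F z := by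
  have e := h.herm_tension_horDzbar hz
  set a := herm (tension F z) (horDz F z) with ha
  have h1 : (herm ((r : ℂ) • tension F z) (diffMap F 1 z)).re = 0 := by
    rw [herm_smul_left, diffMap_one, herm_add_right, e, ← ha]
    simp
  have h2 : (herm ((r : ℂ) • tension F z) (diffMap F Complex.I z)).re = 0 := by
    rw [herm_smul_left, diffMap_I, herm_smul_right, herm_sub_right, e, ← ha]
    simp
  rw [normalPart, h1, h2]
  simp

/-- With f_x = f_z + f_z̄ and f_y = i(f_z - f_z̄), the unmixed covariant derivatives cancel and the
mixed ones remain, as for the Laplacian 4∂_z∂_z̄. -/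
lemma covDeriv_add_covDeriv (hz : z ∈ D) :
    covDeriv F (diffMap F 1) 1 z + covDeriv F (diffMap F Complex.I) Complex.I z
      = (4 : ℂ) • tension F z := by
  have hV := (h.contDiffAt_horDz hz).diffAt
  have hW := (h.contDiffAt_horDzbar hz).diffAt
  have d1 : diffMap F 1 = fun w => horDz F w + horDzbar F w := funext (diffMap_one F)
  have d2 : diffMap F Complex.I = fun w => Complex.I • (horDz F w - horDzbar F w) :=
    funext (diffMap_I F)
  have hc : DifferentiableAt ℝ (fun _ : ℂ => Complex.I) z := by fun_prop
  have hVW : DifferentiableAt ℝ (fun w => horDz F w - horDzbar F w) z := hV.sub hW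
  rw [d1, d2, covDeriv, covDeriv, ← tanProj_add, fderiv_one, fderiv_one, fderiv_I, fderiv_I,
    dz_add hV hW, dzbar_add hV hW, dz_smul hc hVW, dzbar_smul hc hVW, dz_sub hV hW,
    dzbar_sub hV hW, dz_const, dzbar_const]
  -- Twice each of the two expressions of the tension field, matching the two kinds of mixed
  -- derivatives.
  have e : (4 : ℂ) • tension F z = tanProj (F z) ((2 : ℂ) • (dzbar (horDz F) z
      + herm (dzbar F z) (F z) • horDz F z + (dz (horDzbar F) z
      + herm (dz F z) (F z) • horDzbar F z))) := by
    rw [tanProj_smul, tanProj_add, ← h.tension_eq_horDz hz, ← h.tension_eq_horDzbar hz]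
    module
  rw [e, herm_add_left, herm_smul_left, herm_sub_left]
  congr 1
  simp only [zero_smul, zero_add, smul_smul, Complex.I_mul_I, ← smul_sub]
  match_scalars
  · ring
  · ring
  · ring
  · ring
  · linear_combination (herm (dz F z) (F z) - herm (dzbar F z) (F z)) * Complex.I_mul_I
  · linear_combination (herm (dzbar F z) (F z) - herm (dz F z) (F z)) * Complex.I_mul_I

/-- The mean curvature vector is a positive multiple of the complexified tension field. -/
lemma meanCurvature_eq (hz : z ∈ D) :
    meanCurvature F z = ((2 / (inducedForm F z 1 1).re : ℝ) : ℂ) • tension F z := by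
  have h4 := h.normalPart_tension hz 4
  have e : ((4 : ℝ) : ℂ) = 4 := by norm_num
  rw [e] at h4
  rw [meanCurvature, secondForm, secondForm, ← normalPart_add, h.covDeriv_add_covDeriv hz, h4,
    smul_smul]
  congr 1
  push_cast
  ring

lemma meanCurvature_eq_zero_iff (hz : z ∈ D) : meanCurvature F z = 0 ↔ tension F z = 0 := by
  have := h.inducedForm_pos hz
  rw [h.meanCurvature_eq hz, smul_eq_zero]
  refine or_iff_right (Complex.ofReal_ne_zero.2 (by positivity))

end IsLagrangianLift

/-! ### Invariance of the tension field -/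

section Holomorphic

variable {E : Type*} [NormedAddCommGroup E] [NormedSpace ℂ E]

lemma fderiv_real_of_differentiableAt {τ : ℂ → E} {z : ℂ} (hτ : DifferentiableAt ℂ τ z) (X : ℂ) :
    fderiv ℝ τ z X = X • deriv τ z := by
  rw [hτ.fderiv_restrictScalars ℝ]
  simp

lemma dzbar_of_differentiableAt {τ : ℂ → E} {z : ℂ} (hτ : DifferentiableAt ℂ τ z) :
    dzbar τ z = 0 := by
  simp only [dzbar, fderiv_real_of_differentiableAt hτ, smul_smul, Complex.I_mul_I]
  module

lemma fderiv_comp_of_differentiableAt {τ : ℂ → ℂ} {f : ℂ → E} {z : ℂ}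
    (hτ : DifferentiableAt ℂ τ z) (hf : DifferentiableAt ℝ f (τ z)) (X : ℂ) :
    fderiv ℝ (fun w => f (τ w)) z X = (X * deriv τ z) • dz f (τ z)
      + (star X * star (deriv τ z)) • dzbar f (τ z) := by
  have := fderiv_fun_comp (𝕜 := ℝ) z hf (hτ.restrictScalars ℝ)
  rw [this, ContinuousLinearMap.comp_apply, fderiv_real_of_differentiableAt hτ,
    fderiv_eq_dz_add_dzbar, smul_eq_mul, star_mul, mul_comm (star X)]

lemma dz_comp {τ : ℂ → ℂ} {f : ℂ → E} {z : ℂ}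
    (hτ : DifferentiableAt ℂ τ z) (hf : DifferentiableAt ℝ f (τ z)) :
    dz (fun w => f (τ w)) z = deriv τ z • dz f (τ z) := by
  have hI : star Complex.I = -Complex.I := Complex.conj_I
  rw [dz, fderiv_comp_of_differentiableAt hτ hf, fderiv_comp_of_differentiableAt hτ hf, hI,
    star_one]
  match_scalars
  · linear_combination (-(1 / 2) * deriv τ z) * Complex.I_mul_I
  · linear_combination ((1 / 2) * star (deriv τ z)) * Complex.I_mul_I

lemma dzbar_comp {τ : ℂ → ℂ} {f : ℂ → E} {z : ℂ}
    (hτ : DifferentiableAt ℂ τ z) (hf : DifferentiableAt ℝ f (τ z)) :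
    dzbar (fun w => f (τ w)) z = star (deriv τ z) • dzbar f (τ z) := by
  have hI : star Complex.I = -Complex.I := Complex.conj_I
  rw [dzbar, fderiv_comp_of_differentiableAt hτ hf, fderiv_comp_of_differentiableAt hτ hf, hI,
    star_one]
  match_scalars
  · linear_combination ((1 / 2) * deriv τ z) * Complex.I_mul_I
  · linear_combination (-(1 / 2) * star (deriv τ z)) * Complex.I_mul_I

lemma differentiableAt_of_dzbar_eq_zero {f : ℂ → E} {z : ℂ} (hf : DifferentiableAt ℝ f z)
    (h0 : dzbar f z = 0) : DifferentiableAt ℂ f z := by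
  refine (differentiableAt_iff_restrictScalars ℝ hf).2
    ⟨ContinuousLinearMap.toSpanSingleton ℂ (dz f z), ?_⟩
  ext X
  rw [fderiv_eq_dz_add_dzbar, h0]
  simp

end Holomorphic

lemma tension_congr {F F' : ℂ → Fin 4 → ℂ} {z : ℂ} (h : F =ᶠ[nhds z] F') :
    tension F z = tension F' z := by
  rw [tension, tension, dzbar_congr h, dz_congr h, dzbar_congr (eventuallyEq_dz h), h.eq_of_nhds]

/-- As τ is holomorphic, no second derivative of τ enters the mixed derivative; every term picks up
exactly one factor τ' and one factor of its conjugate. -/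
lemma tension_comp {F : ℂ → Fin 4 → ℂ} {τ : ℂ → ℂ} {z : ℂ} (hτ : AnalyticAt ℂ τ z)
    (hF : ContDiffAt ℝ ∞ F (τ z)) :
    tension (fun w => F (τ w)) z = (deriv τ z * star (deriv τ z)) • tension F (τ z) := by
  have hτd := hτ.differentiableAt
  have h1 : dz (fun w => F (τ w)) =ᶠ[nhds z] fun w => deriv τ w • dz F (τ w) := by
    have hF' : ∀ᶠ w in nhds z, DifferentiableAt ℝ F (τ w) := by
      have h2 : ∀ᶠ x in nhds (τ z), ContDiffAt ℝ 1 F x :=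
        (hF.of_le (by exact WithTop.coe_le_coe.2 le_top)).eventually (by simp)
      filter_upwards [hτ.continuousAt.eventually h2] with w hw
      exact hw.differentiableAt (by simp)
    filter_upwards [hτ.eventually_analyticAt, hF'] with w hw hw'
    exact dz_comp hw.differentiableAt hw'
  have h2 : DifferentiableAt ℝ (dz F) (τ z) := (contDiffAt_dz hF).diffAt
  have h3 : DifferentiableAt ℂ (deriv τ) z := hτ.deriv.differentiableAt
  have h4 : DifferentiableAt ℝ (fun w => dz F (τ w)) z :=
    DifferentiableAt.fun_comp' z h2 (hτd.restrictScalars ℝ)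
  rw [tension, dzbar_congr h1, dzbar_smul (h3.restrictScalars ℝ) h4,
    dzbar_of_differentiableAt h3, dzbar_comp hτd h2, dz_comp hτd hF.diffAt,
    dzbar_comp hτd hF.diffAt, herm_smul_left, herm_smul_left, tension, ← tanProj_smul]
  congr 1
  module

/-- The phase corrections in `tension` are there for this: they cancel the cross terms c_z F_z̄ +
c_z̄ F_z of the product rule, while the multiple of F is killed by `tanProj`. -/
lemma tension_smul {F : ℂ → Fin 4 → ℂ} {c : ℂ → ℂ} {z : ℂ} (hc : ContDiffAt ℝ ∞ c z)
    (hF : ContDiffAt ℝ ∞ F z) (hc1 : c z * star (c z) = 1) (hw : herm (F z) (F z) = -1)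
    (hn : bil (F z) (F z) = 0) :
    tension (fun w => c w • F w) z = c z • tension F z := by
  have hev {E : Type} [NormedAddCommGroup E] [NormedSpace ℂ E] {f : ℂ → E}
      (hf : ContDiffAt ℝ ∞ f z) : ∀ᶠ x in nhds z, DifferentiableAt ℝ f x := by
    have h2 : ∀ᶠ x in nhds z, ContDiffAt ℝ 1 f x :=
      (hf.of_le (by exact WithTop.coe_le_coe.2 le_top)).eventually (by simp)
    filter_upwards [h2] with w hw using hw.differentiableAt (by simp)
  have h1 : dz (fun w => c w • F w) =ᶠ[nhds z] fun w => dz c w • F w + c w • dz F w := by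
    filter_upwards [hev hc, hev hF] with w hw hw' using dz_smul hw hw'
  have d1 : DifferentiableAt ℝ (dz c) z := (contDiffAt_dz hc).diffAt
  have d2 : DifferentiableAt ℝ (dz F) z := (contDiffAt_dz hF).diffAt
  have d3 : DifferentiableAt ℝ (fun w => dz c w • F w) z := d1.smul hF.diffAt
  have d4 : DifferentiableAt ℝ (fun w => c w • dz F w) z := hc.diffAt.smul d2
  rw [tension, dzbar_congr h1, dzbar_add d3 d4, dzbar_smul d1 hF.diffAt, dzbar_smul hc.diffAt d2,
    dz_smul hc.diffAt hF.diffAt, dzbar_smul hc.diffAt hF.diffAt, tanProj_smul_base _ _ hc1,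
    tension]
  simp only [tanProj_add, tanProj_smul, tanProj_base hw hn, herm_add_left, herm_smul_left,
    herm_smul_right, hw]
  match_scalars
  · linear_combination (-dz c z + c z * herm (dz F z) (F z)) * hc1
  · linear_combination (-dzbar c z + c z * herm (dzbar F z) (F z)) * hc1
  · ring

/-! ### Independence of the coordinate and of the lift on the surface -/

section Surface

variable {M : Type*} [TopologicalSpace M] [ChartedSpace ℂ M] {f : M → ℙ ℂ (Fin 4 → ℂ)}
  {e e' : OpenPartialHomeomorph M ℂ} {F F' : ℂ → Fin 4 → ℂ}

lemma IsLift.isLagrangianLift (h : IsLift f e F) (hf : IsConformalLagrangianImmersion f) :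
    IsLagrangianLift F e.target where
  isOpen := e.open_target
  smooth := h.smooth
  unit := h.unit
  null z hz := by
    obtain ⟨hF, hFf⟩ := h.lift z hz
    obtain ⟨v, hv, hv0, hvf⟩ := hf.mem_quadric (e.symm z)
    have hv' := (connectedComponentIn_subset _ _ hv).2
    obtain ⟨a, ha⟩ := (Projectivization.mk_eq_mk_iff' ℂ _ _ hF hv0).1 (hFf.symm.trans hvf)
    rw [← ha, bil_smul_left, bil_smul_right, hv', mul_zero, mul_zero]
  immersion := hf.immersion e F h
  conformal := hf.conformal e F h
  lagrangian := hf.lagrangian e F h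

lemma analyticAt_transition (he : e ∈ IsManifold.maximalAtlas 𝓘(ℂ) ω M)
    (he' : e' ∈ IsManifold.maximalAtlas 𝓘(ℂ) ω M) [IsManifold 𝓘(ℂ) ω M] {z : ℂ}
    (hz : z ∈ e'.target) (hz' : e'.symm z ∈ e.source) :
    AnalyticAt ℂ (fun w => e (e'.symm w)) z := by
  have h := IsManifold.compatible_of_mem_maximalAtlas he' he
  have h1 := (contMDiffOn_of_mem_contDiffGroupoid h).contDiffOn
  exact (h1.contDiffAt ((e'.symm ≫ₕ e).open_source.mem_nhds (by simp [hz, hz']))).analyticAt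

/-- Vanishing of the tension field does not depend on the coordinate and on the lift. -/
lemma tension_eq_zero_of_isLift [IsManifold 𝓘(ℂ) ω M] (hf : IsConformalLagrangianImmersion f)
    (h : IsLift f e F) (h' : IsLift f e' F') {z : ℂ} (hz : z ∈ e'.target)
    (hz' : e'.symm z ∈ e.source) (h0 : tension F (e (e'.symm z)) = 0) : tension F' z = 0 := by
  set τ : ℂ → ℂ := fun w => e (e'.symm w) with hτ
  have hτa : AnalyticAt ℂ τ z := analyticAt_transition h.chart h'.chart hz hz'
  have hL := h.isLagrangianLift hf
  have hL' := h'.isLagrangianLift hf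
  have hτz : τ z ∈ e.target := e.map_source hz'
  have hFs := hL.contDiffAt hτz
  have hτs : ContDiffAt ℝ ∞ τ z := hτa.contDiffAt.restrict_scalars ℝ
  have hFτ : ContDiffAt ℝ ∞ (fun w => F (τ w)) z := hFs.comp z hτs
  -- Both lifts represent the same point, so they are proportional; pairing with `F` and using (F,
  -- F) = -1 gives the factor by a formula that is visibly smooth.
  set c : ℂ → ℂ := fun w => -herm (F' w) (F (τ w)) with hc
  have hcs : ContDiffAt ℝ ∞ c z := (contDiffAt_herm (hL'.contDiffAt hz) hFτ).neg
  have key : ∀ w ∈ e'.target, e'.symm w ∈ e.source → F' w = c w • F (τ w)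
      ∧ c w * star (c w) = 1 := by
    intro w hw hw'
    have hτw : τ w ∈ e.target := e.map_source hw'
    obtain ⟨hF0, hF1⟩ := h.lift _ hτw
    obtain ⟨hF0', hF1'⟩ := h'.lift _ hw
    have : e.symm (τ w) = e'.symm w := e.left_inv hw'
    rw [this] at hF1
    obtain ⟨a, ha⟩ := (Projectivization.mk_eq_mk_iff' ℂ _ _ hF0' hF0).1 (hF1'.symm.trans hF1)
    have hca : c w = a := by
      simp only [hc]
      rw [← ha, herm_smul_left, hL.unit _ hτw]; ring
    refine ⟨by rw [hca, ha], ?_⟩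
    have := hL'.unit w hw
    rw [← ha, herm_smul_left, herm_smul_right, hL.unit _ hτw] at this
    rw [hca]
    linear_combination -this
  have hev : F' =ᶠ[nhds z] fun w => c w • F (τ w) := by
    have h1 := e'.symm.continuousAt hz
    filter_upwards [e'.open_target.mem_nhds hz, h1.eventually (e.open_source.mem_nhds hz')] with
      w hw hw' using (key w hw hw').1
  rw [tension_congr hev, tension_smul hcs hFτ (key z hz hz').2 (hL.unit _ hτz) (hL.null _ hτz),
    tension_comp hτa hFs, h0, smul_zero, smul_zero]

/-- The definition of minimality quantifies over all coordinates and lifts; a single lift suffices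
to test it. -/
lemma isMinimalOn_iff_tension [IsManifold 𝓘(ℂ) ω M] (hf : IsConformalLagrangianImmersion f)
    (h : IsLift f e F) : IsMinimalOn f e.source ↔ ∀ z ∈ e.target, tension F z = 0 := by
  constructor
  · intro hm z hz
    exact ((h.isLagrangianLift hf).meanCurvature_eq_zero_iff hz).1
      (hm e F h z hz (e.map_target hz))
  · intro ht e' F' h' z hz hz'
    rw [(h'.isLagrangianLift hf).meanCurvature_eq_zero_iff hz]
    exact tension_eq_zero_of_isLift hf h h' hz hz' (ht _ (e.map_source hz'))

end Surface

/-! ### Horizontal lifts -/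

/-- A horizontal lift of a conformal Lagrangian immersion over an open set. -/
structure IsHorizontalLagrangianLift (F : ℂ → Fin 4 → ℂ) (D : Set ℂ) : Prop
    extends IsLagrangianLift F D where
  horizontal : ∀ z ∈ D, herm (dz F z) (F z) = 0 ∧ herm (dzbar F z) (F z) = 0

/-- `γ = ⟨F_z̄, F_z̄⟩`. -/
def gammaFun (F : ℂ → Fin 4 → ℂ) (z : ℂ) : ℂ := bil (dzbar F z) (dzbar F z)

/-- The unitary function `(αγ - β²) / (F_z, F_z)²`. -/
def phaseFun (F : ℂ → Fin 4 → ℂ) (z : ℂ) : ℂ :=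
  (alphaFun F z * gammaFun F z - betaFun F z * betaFun F z) *
    ((herm (dz F z) (dz F z))⁻¹ * (herm (dz F z) (dz F z))⁻¹)

lemma dz_inv {g : ℂ → ℂ} {z : ℂ} (hg : DifferentiableAt ℝ g z) (h0 : g z ≠ 0) :
    dz (fun w => (g w)⁻¹) z = -dz g z * ((g z)⁻¹ * (g z)⁻¹) := by
  have h1 : (fun w => (g w)⁻¹ * g w) =ᶠ[nhds z] fun _ => 1 := by
    filter_upwards [hg.continuousAt.eventually_ne h0] with w hw using inv_mul_cancel₀ hw
  have h2 := dz_congr h1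
  have hi : DifferentiableAt ℝ (fun w => (g w)⁻¹) z := hg.fun_inv h0
  rw [dz_mul hi hg, dz_const] at h2
  field_simp at h2 ⊢
  linear_combination h2

lemma dzbar_inv {g : ℂ → ℂ} {z : ℂ} (hg : DifferentiableAt ℝ g z) (h0 : g z ≠ 0) :
    dzbar (fun w => (g w)⁻¹) z = -dzbar g z * ((g z)⁻¹ * (g z)⁻¹) := by
  have h1 : (fun w => (g w)⁻¹ * g w) =ᶠ[nhds z] fun _ => 1 := by
    filter_upwards [hg.continuousAt.eventually_ne h0] with w hw using inv_mul_cancel₀ hw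
  have h2 := dzbar_congr h1
  have hi : DifferentiableAt ℝ (fun w => (g w)⁻¹) z := hg.fun_inv h0
  rw [dzbar_mul hi hg, dzbar_const] at h2
  field_simp at h2 ⊢
  linear_combination h2

namespace IsHorizontalLagrangianLift

variable {F : ℂ → Fin 4 → ℂ} {D : Set ℂ} {z : ℂ} (h : IsHorizontalLagrangianLift F D)
include h

lemma horDz_eq_dz (hz : z ∈ D) : horDz F z = dz F z := by
  rw [horDz, hor, (h.horizontal z hz).1, zero_smul, add_zero]

lemma horDzbar_eq_dzbar (hz : z ∈ D) : horDzbar F z = dzbar F z := by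
  rw [horDzbar, hor, (h.horizontal z hz).2, zero_smul, add_zero]

lemma tension_eq (hz : z ∈ D) : tension F z = tanProj (F z) (dzbar (dz F) z) := by
  rw [tension, (h.horizontal z hz).1, (h.horizontal z hz).2, zero_smul, zero_smul, add_zero,
    add_zero]

lemma herm_dz_ne_zero (hz : z ∈ D) : herm (dz F z) (dz F z) ≠ 0 := by
  rw [← h.horDz_eq_dz hz]; exact h.herm_horDz_ne_zero hz

lemma herm_dzbar_self (hz : z ∈ D) :
    herm (dzbar F z) (dzbar F z) = herm (dz F z) (dz F z) := by
  rw [← h.horDz_eq_dz hz, ← h.horDzbar_eq_dzbar hz, h.herm_horDzbar_self hz]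

lemma herm_dz_dzbar (hz : z ∈ D) : herm (dz F z) (dzbar F z) = 0 := by
  rw [← h.horDz_eq_dz hz, ← h.horDzbar_eq_dzbar hz, h.herm_horDz_horDzbar hz]

lemma herm_tension (hz : z ∈ D) :
    herm (tension F z) (horDz F z) = herm (dzbar (dz F) z) (dz F z) := by
  rw [h.tension_eq hz, herm_tanProj_left (h.herm_horDz hz) (h.bil_horDz hz), h.horDz_eq_dz hz]

lemma tension_eq_zero_iff_herm (hz : z ∈ D) :
    tension F z = 0 ↔ herm (dzbar (dz F) z) (dz F z) = 0 := by
  rw [h.tension_eq_zero_iff hz, h.herm_tension hz]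

lemma herm_dzbar_dz_dzbar (hz : z ∈ D) : herm (dzbar (dz F) z) (dzbar F z)
    = -star (herm (dzbar (dz F) z) (dz F z)) := by
  rw [← h.herm_tension hz, ← h.herm_tension_horDzbar hz, h.tension_eq hz,
    herm_tanProj_left (h.herm_horDzbar hz) (h.bil_horDzbar hz), h.horDzbar_eq_dzbar hz]

lemma tanProj_expand_dz (hz : z ∈ D) (v : Fin 4 → ℂ) :
    tanProj (F z) v = (herm v (dz F z) / herm (dz F z) (dz F z)) • dz F z
      + (herm v (dzbar F z) / herm (dz F z) (dz F z)) • dzbar F z := by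
  rw [h.tanProj_expand hz, h.horDz_eq_dz hz, h.horDzbar_eq_dzbar hz]

omit h in
lemma bil_tanProj {w v a : Fin 4 → ℂ} (ha : herm a w = 0) (ha' : bil a w = 0) :
    bil (tanProj w v) a = bil v a := by
  rw [tanProj, bil_add_left, bil_add_left, bil_smul_left, bil_smul_left, bil_star_left, ha,
    bil_comm w, ha']
  ring

/-- F_z is ⟨ , ⟩-orthogonal to F and F̄, so only the tangential part of v contributes, and that part
has known components along F_z and F_z̄. -/
lemma bil_dz_right (hz : z ∈ D) (v : Fin 4 → ℂ) : bil v (dz F z) =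
    (herm v (dz F z) * alphaFun F z + herm v (dzbar F z) * betaFun F z)
      / herm (dz F z) (dz F z) := by
  rw [← bil_tanProj (h.horizontal z hz).1 (h.bil_dz hz), h.tanProj_expand_dz hz, bil_add_left,
    bil_smul_left, bil_smul_left, bil_comm (dzbar F z), alphaFun, betaFun]
  ring

lemma bil_dzbar_right (hz : z ∈ D) (v : Fin 4 → ℂ) : bil v (dzbar F z) =
    (herm v (dz F z) * betaFun F z + herm v (dzbar F z) * gammaFun F z)
      / herm (dz F z) (dz F z) := by
  rw [← bil_tanProj (h.horizontal z hz).2 (h.bil_dzbar hz), h.tanProj_expand_dz hz, bil_add_left,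
    bil_smul_left, bil_smul_left, gammaFun, betaFun]
  ring

/-- Conjugation exchanges the two conditions (v, F) = 0 and ⟨v, F⟩ = 0, so the conjugate of F_z is
again tangent and expands in F_z, F_z̄. Its components are Hermitian products with a conjugate
vector, that is, conjugated values of ⟨ , ⟩. -/
lemma star_dz (hz : z ∈ D) : herm (dz F z) (dz F z) • star (dz F z)
    = star (alphaFun F z) • dz F z + star (betaFun F z) • dzbar F z := by
  have h1 : tanProj (F z) (star (dz F z)) = star (dz F z) := by
    rw [tanProj, herm_star_left, h.bil_dz hz, herm_star_star, ← star_herm,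
      (h.horizontal z hz).1]
    simp
  have h0 := h.herm_dz_ne_zero hz
  rw [← h1, h.tanProj_expand_dz hz, smul_add, smul_smul, smul_smul, mul_div_cancel₀ _ h0,
    mul_div_cancel₀ _ h0, herm_star_left, herm_star_left]
  rfl

/-- The Gram matrix of `F_z` and `F_z̄` with respect to `⟨ , ⟩` is a multiple of a unitary
matrix. -/
lemma alpha_mul_star_add (hz : z ∈ D) :
    star (alphaFun F z) * alphaFun F z + star (betaFun F z) * betaFun F z
      = herm (dz F z) (dz F z) * herm (dz F z) (dz F z) := by
  have h1 := congrArg (fun v => bil v (dz F z)) (h.star_dz hz)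
  simp only [bil_smul_left, bil_add_left, bil_star_left] at h1
  rw [bil_comm (dzbar F z)] at h1
  exact h1.symm

/-- Orthogonality of the two rows of the Gram matrix, obtained by pairing `star_dz` with F_z̄. -/
lemma alpha_beta_gamma (hz : z ∈ D) :
    star (alphaFun F z) * betaFun F z + star (betaFun F z) * gammaFun F z = 0 := by
  have h1 := congrArg (fun v => bil v (dzbar F z)) (h.star_dz hz)
  simp only [bil_smul_left, bil_add_left, bil_star_left] at h1
  rw [← star_herm (dz F z) (dzbar F z), h.herm_dz_dzbar hz] at h1
  simp only [star_zero, mul_zero] at h1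
  exact h1.symm

/-- For ρ times a unitary matrix, the adjugate is the conjugate transpose times the unitary
determinant; this is its off-diagonal entry. -/
lemma beta_eq (hz : z ∈ D) : betaFun F z = -(phaseFun F z * star (betaFun F z)) := by
  have h0 := h.herm_dz_ne_zero hz
  rw [phaseFun]
  field_simp
  linear_combination (-betaFun F z) * h.alpha_mul_star_add hz
    + (alphaFun F z) * h.alpha_beta_gamma hz

lemma contDiffAt_dz (hz : z ∈ D) : ContDiffAt ℝ ∞ (dz F) z :=
  HypQuadric.contDiffAt_dz (h.contDiffAt hz)

lemma contDiffAt_dzbar (hz : z ∈ D) : ContDiffAt ℝ ∞ (dzbar F) z :=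
  HypQuadric.contDiffAt_dzbar (h.contDiffAt hz)

lemma differentiableAt_alpha (hz : z ∈ D) : DifferentiableAt ℝ (alphaFun F) z :=
  (contDiffAt_bil (h.contDiffAt_dz hz) (h.contDiffAt_dz hz)).diffAt

lemma differentiableAt_beta (hz : z ∈ D) : DifferentiableAt ℝ (betaFun F) z :=
  (contDiffAt_bil (h.contDiffAt_dz hz) (h.contDiffAt_dzbar hz)).diffAt

lemma differentiableAt_gamma (hz : z ∈ D) : DifferentiableAt ℝ (gammaFun F) z :=
  (contDiffAt_bil (h.contDiffAt_dzbar hz) (h.contDiffAt_dzbar hz)).diffAt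

lemma differentiableAt_herm (hz : z ∈ D) :
    DifferentiableAt ℝ (fun w => herm (dz F w) (dz F w)) z :=
  (contDiffAt_herm (h.contDiffAt_dz hz) (h.contDiffAt_dz hz)).diffAt

lemma differentiableAt_det (hz : z ∈ D) : DifferentiableAt ℝ
    (fun w => alphaFun F w * gammaFun F w - betaFun F w * betaFun F w) z :=
  ((h.differentiableAt_alpha hz).mul (h.differentiableAt_gamma hz)).sub
    ((h.differentiableAt_beta hz).mul (h.differentiableAt_beta hz))

lemma differentiableAt_herm_inv (hz : z ∈ D) : DifferentiableAt ℝ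
    (fun w => (herm (dz F w) (dz F w))⁻¹) z :=
  (h.differentiableAt_herm hz).fun_inv (h.herm_dz_ne_zero hz)

lemma differentiableAt_phase (hz : z ∈ D) : DifferentiableAt ℝ (phaseFun F) z :=
  (h.differentiableAt_det hz).mul
    ((h.differentiableAt_herm_inv hz).mul (h.differentiableAt_herm_inv hz))

/-- α_z̄ is 2⟨F_zz̄, F_z⟩; of the two components of F_zz̄, normality of the tension field expresses
the one along F_z̄ by the one along F_z. -/
lemma dzbar_alpha (hz : z ∈ D) : dzbar (alphaFun F) z =
    2 * (herm (dzbar (dz F) z) (dz F z) * alphaFun F z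
      - star (herm (dzbar (dz F) z) (dz F z)) * betaFun F z) / herm (dz F z) (dz F z) := by
  have hd := (h.contDiffAt_dz hz).diffAt
  have := HypQuadric.dzbar_bil hd hd
  rw [show alphaFun F = fun w => bil (dz F w) (dz F w) from rfl, this, bil_comm (dz F z),
    h.bil_dz_right hz, h.herm_dzbar_dz_dzbar hz, alphaFun]
  ring

/-- In the logarithmic derivative of det/ρ² the contributions of F_zz to the determinant and to ρ²
cancel. What is left comes from F_zz̄ alone: -2ā from each of numerator and denominator, divided by
ρ. -/
lemma dz_phase (hz : z ∈ D) : dz (phaseFun F) z =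
    -(4 * star (herm (dzbar (dz F) z) (dz F z)) * phaseFun F z / herm (dz F z) (dz F z)) := by
  have hd := (h.contDiffAt_dz hz).diffAt
  have hd' := (h.contDiffAt_dzbar hz).diffAt
  have h0 := h.herm_dz_ne_zero hz
  have hα : dz (alphaFun F) z = _ := HypQuadric.dz_bil hd hd
  have hβ : dz (betaFun F) z = _ := HypQuadric.dz_bil hd hd'
  have hγ : dz (gammaFun F) z = _ := HypQuadric.dz_bil hd' hd'
  have hρ := dz_herm hd hd
  have hi := dz_inv (h.differentiableAt_herm hz) h0
  have hia := h.differentiableAt_herm_inv hz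
  have h3 : dz (phaseFun F) z = _ := dz_mul (h.differentiableAt_det hz) (hia.fun_mul hia)
  rw [dz_mul hia hia, hi,
    dz_sub ((h.differentiableAt_alpha hz).fun_mul (h.differentiableAt_gamma hz))
    ((h.differentiableAt_beta hz).fun_mul (h.differentiableAt_beta hz)),
    dz_mul (h.differentiableAt_alpha hz) (h.differentiableAt_gamma hz),
    dz_mul (h.differentiableAt_beta hz) (h.differentiableAt_beta hz), hρ, hα, hβ, hγ,
    dzbar_dz (h.contDiffAt hz), bil_comm (dz F z) (dz (dz F) z),
    bil_comm (dzbar F z) (dzbar (dz F) z), bil_comm (dz F z) (dzbar (dz F) z),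
    h.bil_dz_right hz, h.bil_dz_right hz, h.bil_dzbar_right hz,
    h.bil_dzbar_right hz, ← star_herm (dzbar (dz F) z) (dz F z), h.herm_dzbar_dz_dzbar hz] at h3
  rw [h3, phaseFun]
  field_simp
  ring

lemma dzbar_phase (hz : z ∈ D) : dzbar (phaseFun F) z =
    4 * herm (dzbar (dz F) z) (dz F z) * phaseFun F z / herm (dz F z) (dz F z) := by
  have hd := (h.contDiffAt_dz hz).diffAt
  have hd' := (h.contDiffAt_dzbar hz).diffAt
  have h0 := h.herm_dz_ne_zero hz
  have hα : dzbar (alphaFun F) z = _ := HypQuadric.dzbar_bil hd hd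
  have hβ : dzbar (betaFun F) z = _ := HypQuadric.dzbar_bil hd hd'
  have hγ : dzbar (gammaFun F) z = _ := HypQuadric.dzbar_bil hd' hd'
  -- Writing ρ as (F_z̄, F_z̄) makes its z̄-derivative contain F_z̄z̄ in the form needed to cancel
  -- the term from the determinant.
  have hev : (fun w => herm (dz F w) (dz F w)) =ᶠ[nhds z]
      fun w => herm (dzbar F w) (dzbar F w) := by
    filter_upwards [h.eventually_mem hz] with w hw using (h.herm_dzbar_self hw).symm
  have hρ := (dzbar_congr hev).trans (dzbar_herm hd' hd')
  have hi := dzbar_inv (h.differentiableAt_herm hz) h0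
  have hia := h.differentiableAt_herm_inv hz
  have h3 : dzbar (phaseFun F) z = _ := dzbar_mul (h.differentiableAt_det hz) (hia.fun_mul hia)
  rw [dzbar_mul hia hia, hi,
    dzbar_sub ((h.differentiableAt_alpha hz).fun_mul (h.differentiableAt_gamma hz))
    ((h.differentiableAt_beta hz).fun_mul (h.differentiableAt_beta hz)),
    dzbar_mul (h.differentiableAt_alpha hz) (h.differentiableAt_gamma hz),
    dzbar_mul (h.differentiableAt_beta hz) (h.differentiableAt_beta hz), hρ, hα, hβ, hγ,
    dzbar_dz (h.contDiffAt hz), bil_comm (dz F z) (dzbar (dz F) z),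
    bil_comm (dzbar F z) (dzbar (dzbar F) z), bil_comm (dz F z) (dzbar (dzbar F) z),
    h.bil_dz_right hz, h.bil_dz_right hz, h.bil_dzbar_right hz,
    h.bil_dzbar_right hz, ← star_herm (dzbar (dz F) z) (dzbar F z),
    h.herm_dzbar_dz_dzbar hz, star_neg, star_star] at h3
  rw [h3, phaseFun]
  field_simp
  ring

/-- Once the unitary function is a constant δ, the relation β = -δ β̄ confines β to one real line
through the origin. Its direction is read off at a point with β ≠ 0. -/
lemma constant_phase (hD : IsPreconnected D) (ht : ∀ z ∈ D, tension F z = 0) :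
    HasConstantPhase (betaFun F) D := by
  by_cases hb : ∀ z ∈ D, betaFun F z = 0
  · exact ⟨0, fun z hz => ⟨0, by rw [hb z hz]; simp⟩⟩
  push Not at hb
  obtain ⟨z₀, hz₀, hb₀⟩ := hb
  have hconst : ∀ z ∈ D, phaseFun F z = phaseFun F z₀ := by
    intro z hz
    refine h.isOpen.is_const_of_fderiv_eq_zero (𝕜 := ℝ) hD
      (fun w hw => (h.differentiableAt_phase hw).differentiableWithinAt) ?_ hz hz₀
    intro w hw
    have h0 := (h.tension_eq_zero_iff_herm hw).1 (ht w hw)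
    ext X
    rw [fderiv_eq_dz_add_dzbar, h.dz_phase hw, h.dzbar_phase hw, h0]
    simp
  set θ := Complex.arg (betaFun F z₀) with hθ
  have hE : Complex.exp (θ * Complex.I) * Complex.exp (-(θ * Complex.I)) = 1 := by
    rw [← Complex.exp_add]; simp
  have hEs : star (Complex.exp (θ * Complex.I)) = Complex.exp (-(θ * Complex.I)) := by
    rw [Complex.star_def, ← Complex.exp_conj]; simp
  have hEs' : star (Complex.exp (-(θ * Complex.I))) = Complex.exp (θ * Complex.I) := by
    rw [← hEs, star_star]
  have hβ₀ : betaFun F z₀ = ‖betaFun F z₀‖ * Complex.exp (θ * Complex.I) :=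
    (Complex.norm_mul_exp_arg_mul_I _).symm
  -- A nonzero value with argument θ satisfies β / β̄ = e^{2iθ}.
  have hδ : -phaseFun F z₀ = Complex.exp (θ * Complex.I) * Complex.exp (θ * Complex.I) := by
    have h1 := h.beta_eq hz₀
    rw [hβ₀, star_mul, hEs] at h1
    have hn : (‖betaFun F z₀‖ : ℂ) ≠ 0 := by simpa using hb₀
    have hs : star (‖betaFun F z₀‖ : ℂ) = ‖betaFun F z₀‖ := Complex.conj_ofReal _
    rw [hs] at h1
    have h2 : Complex.exp (θ * Complex.I) = -phaseFun F z₀ * Complex.exp (-(θ * Complex.I)) :=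
      mul_left_cancel₀ hn (by linear_combination h1)
    linear_combination (-Complex.exp (θ * Complex.I)) * h2 + phaseFun F z₀ * hE
  refine ⟨θ, fun z hz => ⟨(betaFun F z * Complex.exp (-(θ * Complex.I))).re, ?_⟩⟩
  -- Rotated back by θ, β equals its own conjugate, so its real part serves as t.
  have h1 : star (betaFun F z * Complex.exp (-(θ * Complex.I)))
      = betaFun F z * Complex.exp (-(θ * Complex.I)) := by
    have h2 := h.beta_eq hz
    rw [hconst z hz] at h2
    rw [star_mul, hEs']
    linear_combination (-Complex.exp (-(θ * Complex.I))) * h2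
      - star (betaFun F z) * Complex.exp (-(θ * Complex.I)) * hδ
      - star (betaFun F z) * Complex.exp (θ * Complex.I) * hE
  rw [Complex.conj_eq_iff_re.1 h1]
  linear_combination (-betaFun F z) * hE

/-- The tension field vanishes iff `α` is holomorphic and `β` has constant phase. -/
lemma tension_eq_zero_iff_alpha_beta (hD : IsPreconnected D) :
    (∀ z ∈ D, tension F z = 0) ↔
      DifferentiableOn ℂ (alphaFun F) D ∧ HasConstantPhase (betaFun F) D := by
  constructor
  · intro ht
    refine ⟨fun z hz => ?_, h.constant_phase hD ht⟩
    refine (differentiableAt_of_dzbar_eq_zero (h.differentiableAt_alpha hz)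
      ?_).differentiableWithinAt
    rw [h.dzbar_alpha hz, (h.tension_eq_zero_iff_herm hz).1 (ht z hz)]
    simp
  · rintro ⟨hα, θ, hθ⟩ z hz
    rw [h.tension_eq_zero_iff_herm hz]
    have h0 := h.herm_dz_ne_zero hz
    -- At a zero of β the phase carries no information, but there |α| = ρ ≠ 0 and α_z̄ = 0 reads aα
    -- = 0. Elsewhere the phase of β fixes δ on a neighbourhood, so δ_z = 0, and δ_z is a nonzero
    -- multiple of ā.
    by_cases hb : betaFun F z = 0
    · have h1 := h.dzbar_alpha hz
      rw [dzbar_of_differentiableAt (hα.differentiableAt (h.isOpen.mem_nhds hz)), hb, mul_zero,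
        sub_zero, eq_comm, div_eq_zero_iff, or_iff_left h0] at h1
      have h2 := h.alpha_mul_star_add hz
      have h3 : alphaFun F z ≠ 0 := by
        intro h4
        rw [h4, hb, mul_zero, add_zero, eq_comm, mul_self_eq_zero] at h2
        exact h0 h2
      simpa [h3] using h1
    · have hev : phaseFun F =ᶠ[nhds z]
          fun _ => -(Complex.exp (θ * Complex.I) * Complex.exp (θ * Complex.I)) := by
        filter_upwards [h.eventually_mem hz,
          (h.differentiableAt_beta hz).continuousAt.eventually_ne hb] with w hw hbw
        obtain ⟨t, ht⟩ := hθ w hw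
        have hE : Complex.exp (θ * Complex.I) * Complex.exp (-(θ * Complex.I)) = 1 := by
          rw [← Complex.exp_add]; simp
        have hEs : star (Complex.exp (θ * Complex.I)) = Complex.exp (-(θ * Complex.I)) := by
          rw [Complex.star_def, ← Complex.exp_conj]; simp
        have ht0 : (t : ℂ) ≠ 0 := by
          intro h1; rw [h1, zero_mul] at ht; exact hbw ht
        have hts : star (t : ℂ) = t := Complex.conj_ofReal _
        have h1 := h.beta_eq hw
        rw [ht, star_mul, hEs, hts] at h1
        have h2 : Complex.exp (θ * Complex.I) = -phaseFun F w * Complex.exp (-(θ * Complex.I)) :=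
          mul_left_cancel₀ ht0 (by linear_combination h1)
        linear_combination Complex.exp (θ * Complex.I) * h2 - phaseFun F w * hE
      have h1 := h.dz_phase hz
      rw [dz_congr hev, dz_const, eq_comm, neg_eq_zero, div_eq_zero_iff, or_iff_left h0] at h1
      have h2 : phaseFun F z ≠ 0 := by rw [hev.eq_of_nhds]; simp
      simpa [h2] using h1

end IsHorizontalLagrangianLift

/-- For a continuous nowhere vanishing function on a connected set, the phase is constant iff the
argument is constant. -/
lemma hasConstantPhase_iff_arg {g : ℂ → ℂ} {D : Set ℂ} (hD : IsPreconnected D)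
    (hg : ContinuousOn g D) (h0 : ∀ z ∈ D, g z ≠ 0) :
    HasConstantPhase g D ↔ ∃ φ : ℝ, ∀ z ∈ D, Complex.arg (g z) = φ := by
  constructor
  · rintro ⟨θ, hθ⟩
    have hE : Complex.exp (θ * Complex.I) * Complex.exp (-(θ * Complex.I)) = 1 := by
      rw [← Complex.exp_add]; simp
    -- The real factor is recovered from g by a continuous formula. Being nowhere zero on a
    -- connected set, it keeps its sign, and values of g differ by positive factors.
    set t : ℂ → ℝ := fun z => (g z * Complex.exp (-(θ * Complex.I))).re with ht
    have htc : ContinuousOn t D :=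
      Complex.continuous_re.comp_continuousOn (hg.mul continuousOn_const)
    have hgt : ∀ z ∈ D, g z = t z * Complex.exp (θ * Complex.I) := by
      intro z hz
      obtain ⟨s, hs⟩ := hθ z hz
      have : t z = s := by
        simp only [ht]
        rw [hs, mul_assoc, hE, mul_one, Complex.ofReal_re]
      rw [this, hs]
    have ht0 : ∀ z ∈ D, t z ≠ 0 := by
      intro z hz h1
      apply h0 z hz
      rw [hgt z hz, h1]; simp
    rcases D.eq_empty_or_nonempty with rfl | ⟨z₀, hz₀⟩
    · exact ⟨0, by simp⟩
    refine ⟨Complex.arg (g z₀), fun z hz => ?_⟩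
    have hpos : 0 < t z / t z₀ := by
      by_contra! hneg
      have hneg' : t z * t z₀ ≤ 0 := by
        by_contra! hp
        have : t z / t z₀ = t z * t z₀ / t z₀ ^ 2 := by
          field_simp [ht0 z₀ hz₀]
        rw [this] at hneg
        have := div_pos hp (pow_pos (abs_pos.2 (ht0 z₀ hz₀)) 2)
        rw [sq_abs] at this
        linarith
      have hmem : (0 : ℝ) ∈ t '' D := by
        rcases mul_nonpos_iff.1 hneg' with h1 | h1
        · exact hD.intermediate_value hz₀ hz htc ⟨h1.2, h1.1⟩
        · exact hD.intermediate_value hz hz₀ htc ⟨h1.1, h1.2⟩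
      obtain ⟨w, hw, hw0⟩ := hmem
      exact ht0 w hw hw0
    have : g z = ((t z / t z₀ : ℝ) : ℂ) * g z₀ := by
      rw [hgt z hz, hgt z₀ hz₀]
      have : (t z₀ : ℂ) ≠ 0 := Complex.ofReal_ne_zero.2 (ht0 z₀ hz₀)
      push_cast
      field_simp
    rw [this, Complex.arg_real_mul _ hpos]
  · rintro ⟨φ, hφ⟩
    exact ⟨φ, fun z hz => ⟨‖g z‖, by rw [← hφ z hz, Complex.norm_mul_exp_arg_mul_I]⟩⟩

/-! ### Matrix calculus -/

section MatrixCalculus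

/-- Entrywise smoothness of a matrix-valued function at a point. -/
def SmoothMatAt (A : ℂ → Matrix (Fin 4) (Fin 4) ℂ) (z : ℂ) : Prop :=
  ∀ i j, ContDiffAt ℝ ∞ (fun w => A w i j) z

variable {A B : ℂ → Matrix (Fin 4) (Fin 4) ℂ} {z : ℂ}

lemma SmoothMatAt.differentiableAt (hA : SmoothMatAt A z) (i j : Fin 4) :
    DifferentiableAt ℝ (fun w => A w i j) z := (hA i j).diffAt

lemma SmoothMatAt.matDz (hA : SmoothMatAt A z) : SmoothMatAt (matDz A) z :=
  fun i j => contDiffAt_dz (hA i j)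

lemma SmoothMatAt.matDzbar (hA : SmoothMatAt A z) : SmoothMatAt (matDzbar A) z :=
  fun i j => contDiffAt_dzbar (hA i j)

lemma SmoothMatAt.mul (hA : SmoothMatAt A z) (hB : SmoothMatAt B z) :
    SmoothMatAt (fun w => A w * B w) z := fun i j => by
  simp only [Matrix.mul_apply]
  exact ContDiffAt.sum fun k _ => (hA i k).mul (hB k j)

lemma SmoothMatAt.transpose (hA : SmoothMatAt A z) : SmoothMatAt (fun w => (A w)ᵀ) z :=
  fun i j => hA j i

lemma smoothMatAt_const (c : Matrix (Fin 4) (Fin 4) ℂ) : SmoothMatAt (fun _ => c) z :=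
  fun _ _ => contDiffAt_const

lemma SmoothMatAt.congr (hA : SmoothMatAt A z) (h : B =ᶠ[nhds z] A) : SmoothMatAt B z :=
  fun i j => (hA i j).congr_of_eventuallyEq (h.mono fun _ hw => by simp only [hw])

lemma dz_sum {ι : Type*} (s : Finset ι) {f : ι → ℂ → ℂ}
    (hf : ∀ i, DifferentiableAt ℝ (f i) z) :
    dz (fun w => ∑ i ∈ s, f i w) z = ∑ i ∈ s, dz (f i) z := by
  classical
  induction s using Finset.induction_on with
  | empty => simp [dz_const]
  | insert a s ha ih =>
    simp only [Finset.sum_insert ha]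
    rw [dz_add (hf a) (DifferentiableAt.fun_sum fun i _ => hf i), ih]

lemma dzbar_sum {ι : Type*} (s : Finset ι) {f : ι → ℂ → ℂ}
    (hf : ∀ i, DifferentiableAt ℝ (f i) z) :
    dzbar (fun w => ∑ i ∈ s, f i w) z = ∑ i ∈ s, dzbar (f i) z := by
  classical
  induction s using Finset.induction_on with
  | empty => simp [dzbar_const]
  | insert a s ha ih =>
    simp only [Finset.sum_insert ha]
    rw [dzbar_add (hf a) (DifferentiableAt.fun_sum fun i _ => hf i), ih]

lemma matDz_mul (hA : SmoothMatAt A z) (hB : SmoothMatAt B z) :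
    matDz (fun w => A w * B w) z = matDz A z * B z + A z * matDz B z := by
  ext i j
  simp only [matDz, Matrix.of_apply, Matrix.add_apply, Matrix.mul_apply]
  rw [dz_sum _ fun k => ((hA i k).mul (hB k j)).diffAt, ← Finset.sum_add_distrib]
  exact Finset.sum_congr rfl fun k _ => dz_mul (hA.differentiableAt i k) (hB.differentiableAt k j)

lemma matDzbar_mul (hA : SmoothMatAt A z) (hB : SmoothMatAt B z) :
    matDzbar (fun w => A w * B w) z = matDzbar A z * B z + A z * matDzbar B z := by
  ext i j
  simp only [matDzbar, Matrix.of_apply, Matrix.add_apply, Matrix.mul_apply]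
  rw [dzbar_sum _ fun k => ((hA i k).mul (hB k j)).diffAt, ← Finset.sum_add_distrib]
  exact Finset.sum_congr rfl fun k _ =>
    dzbar_mul (hA.differentiableAt i k) (hB.differentiableAt k j)

lemma matDz_const (c : Matrix (Fin 4) (Fin 4) ℂ) : matDz (fun _ => c) z = 0 := by
  ext i j; simp [matDz, dz_const]

lemma matDz_congr (h : A =ᶠ[nhds z] B) : matDz A z = matDz B z := by
  ext i j; exact dz_congr (h.mono fun _ hw => by simp only [hw])

lemma matDzbar_congr (h : A =ᶠ[nhds z] B) : matDzbar A z = matDzbar B z := by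
  ext i j; exact dzbar_congr (h.mono fun _ hw => by simp only [hw])

lemma matDzbar_matDz (hA : SmoothMatAt A z) :
    matDz (matDzbar A) z = matDzbar (matDz A) z := by
  ext i j; exact dzbar_dz (hA i j)

lemma matDz_map_star : matDz (fun w => (A w).map star) z = (matDzbar A z).map star := by
  ext i j; exact dz_star (fun w => A w i j) z

lemma matDzbar_map_star : matDzbar (fun w => (A w).map star) z = (matDz A z).map star := by
  ext i j; exact dzbar_star (fun w => A w i j) z

lemma dz_mulVec (hA : SmoothMatAt A z) (x : Fin 4 → ℂ) :
    dz (fun w => A w *ᵥ x) z = matDz A z *ᵥ x := by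
  have hd : DifferentiableAt ℝ (fun w => A w *ᵥ x) z :=
    differentiableAt_pi.2 fun i => by
      simp only [Matrix.mulVec, dotProduct]
      exact (ContDiffAt.sum fun k _ => (hA i k).mul contDiffAt_const).diffAt
  ext i
  rw [← dz_apply hd]
  simp only [Matrix.mulVec, dotProduct]
  rw [dz_sum _ fun k => ((hA i k).mul contDiffAt_const).diffAt]
  refine Finset.sum_congr rfl fun k _ => ?_
  rw [dz_mul (hA.differentiableAt i k) (by fun_prop), dz_const, mul_zero, add_zero]
  rfl

lemma dzbar_mulVec (hA : SmoothMatAt A z) (x : Fin 4 → ℂ) :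
    dzbar (fun w => A w *ᵥ x) z = matDzbar A z *ᵥ x := by
  have hd : DifferentiableAt ℝ (fun w => A w *ᵥ x) z :=
    differentiableAt_pi.2 fun i => by
      simp only [Matrix.mulVec, dotProduct]
      exact (ContDiffAt.sum fun k _ => (hA i k).mul contDiffAt_const).diffAt
  ext i
  rw [← dzbar_apply hd]
  simp only [Matrix.mulVec, dotProduct]
  rw [dzbar_sum _ fun k => ((hA i k).mul contDiffAt_const).diffAt]
  refine Finset.sum_congr rfl fun k _ => ?_
  rw [dzbar_mul (hA.differentiableAt i k) (by fun_prop), dzbar_const, mul_zero, add_zero]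
  rfl

/-- The signs of the entries of `diag(1, 1, -1, -1)`. -/
def blockSign : Fin 4 → ℂ := ![1, 1, -1, -1]

lemma pPart_apply (X : Matrix (Fin 4) (Fin 4) ℂ) (i j : Fin 4) :
    pPart X i j = (1 / 2 * (1 - blockSign i * blockSign j)) * X i j := by
  simp [pPart, sigmaInv, blockSign]; ring

lemma kPart_apply (X : Matrix (Fin 4) (Fin 4) ℂ) (i j : Fin 4) :
    kPart X i j = (1 / 2 * (1 + blockSign i * blockSign j)) * X i j := by
  simp [kPart, sigmaInv, blockSign]; ring

lemma dz_const_mul (c : ℂ) {f : ℂ → ℂ} (hf : DifferentiableAt ℝ f z) :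
    dz (fun w => c * f w) z = c * dz f z := by
  rw [dz_mul (by fun_prop) hf, dz_const, zero_mul, zero_add]

lemma dzbar_const_mul (c : ℂ) {f : ℂ → ℂ} (hf : DifferentiableAt ℝ f z) :
    dzbar (fun w => c * f w) z = c * dzbar f z := by
  rw [dzbar_mul (by fun_prop) hf, dzbar_const, zero_mul, zero_add]

/-- `pPart` and `kPart` scale each entry by a constant, so they commute with differentiation. The
weights c and d leave room for the spectral parameter on the 𝔭-part. -/
lemma matDzbar_loop (hA : SmoothMatAt A z) (c d : ℂ) :
    matDzbar (fun w => c • pPart (A w) + d • kPart (A w)) z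
      = c • pPart (matDzbar A z) + d • kPart (matDzbar A z) := by
  ext i j
  simp only [matDzbar, Matrix.of_apply, Matrix.add_apply, Matrix.smul_apply, pPart_apply,
    kPart_apply, smul_eq_mul, ← mul_assoc, ← add_mul]
  rw [dzbar_const_mul _ (hA.differentiableAt i j)]

lemma matDz_loop (hA : SmoothMatAt A z) (c d : ℂ) :
    matDz (fun w => c • pPart (A w) + d • kPart (A w)) z
      = c • pPart (matDz A z) + d • kPart (matDz A z) := by
  ext i j
  simp only [matDz, Matrix.of_apply, Matrix.add_apply, Matrix.smul_apply, pPart_apply,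
    kPart_apply, smul_eq_mul, ← mul_assoc, ← add_mul]
  rw [dz_const_mul _ (hA.differentiableAt i j)]

end MatrixCalculus

/-! ### The obstruction to flatness of the loop of connections -/

section Obstruction

variable (U V U₁ V₁ : Matrix (Fin 4) (Fin 4) ℂ)

/-- The obstruction `(U_𝔭)_z̄ - [U_𝔭, V_𝔨]` to flatness of the loop of connections, where `U₁`
stands for `U_z̄`. -/
def flatObstruction : Matrix (Fin 4) (Fin 4) ℂ :=
  pPart U₁ - (pPart U * kPart V - kPart V * pPart U)

lemma sigmaInv_mul : sigmaInv (U * V) = sigmaInv U * sigmaInv V := by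
  have h : (Matrix.diagonal ![1, 1, -1, -1] : Matrix (Fin 4) (Fin 4) ℂ)
      * Matrix.diagonal ![1, 1, -1, -1] = 1 := by
    rw [Matrix.diagonal_mul_diagonal, ← Matrix.diagonal_one]
    congr 1
    ext i; fin_cases i <;> simp
  simp only [sigmaInv, Matrix.mul_assoc]
  rw [← Matrix.mul_assoc (Matrix.diagonal _) (Matrix.diagonal _), h, Matrix.one_mul]

lemma sigmaInv_sub : sigmaInv (U - V) = sigmaInv U - sigmaInv V := by
  simp [sigmaInv, Matrix.mul_sub, Matrix.sub_mul]

/-- Since σ is multiplicative, its eigenspaces grade the matrix algebra by ℤ/2. -/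
lemma pPart_mul : pPart (U * V) = pPart U * kPart V + kPart U * pPart V := by
  simp only [pPart, kPart, sigmaInv_mul, smul_mul_assoc, mul_smul_comm, mul_add, add_mul, mul_sub,
    sub_mul]
  module

lemma kPart_mul : kPart (U * V) = kPart U * kPart V + pPart U * pPart V := by
  simp only [pPart, kPart, sigmaInv_mul, smul_mul_assoc, mul_smul_comm, mul_add, add_mul, mul_sub,
    sub_mul]
  module

lemma pPart_sub : pPart (U - V) = pPart U - pPart V := by
  simp only [pPart, sigmaInv_sub]; module

lemma kPart_sub : kPart (U - V) = kPart U - kPart V := by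
  simp only [kPart, sigmaInv_sub]; module

variable {U V U₁ V₁}

/-- The curvature of the loop of connections. -/
lemma loop_curvature (hMC : U₁ - V₁ = U * V - V * U) {c : ℂ} (hc : c ≠ 0) :
    (c⁻¹ • pPart U₁ + kPart U₁) - (kPart V₁ + c • pPart V₁)
      - ((c⁻¹ • pPart U + kPart U) * (kPart V + c • pPart V)
        - (kPart V + c • pPart V) * (c⁻¹ • pPart U + kPart U))
      = (c⁻¹ - c) • flatObstruction U V U₁ := by
  have hp := congrArg pPart hMC
  have hk := congrArg kPart hMC
  rw [pPart_sub, pPart_sub, pPart_mul, pPart_mul] at hp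
  rw [kPart_sub, kPart_sub, kPart_mul, kPart_mul] at hk
  rw [flatObstruction]
  simp only [mul_add, add_mul, smul_mul_assoc, mul_smul_comm, smul_add, smul_sub, smul_smul,
    mul_inv_cancel₀ hc, inv_mul_cancel₀ hc]
  -- The 𝔨-part of the Maurer-Cartan equation removes the term constant in c; its 𝔭-part shows that
  -- the coefficients of c⁻¹ and c are opposite.
  linear_combination (norm := module) hk + c • hp

lemma map_star_mul (X Y : Matrix (Fin 4) (Fin 4) ℂ) :
    (X * Y).map star = X.map star * Y.map star := by
  ext i j; simp [Matrix.mul_apply]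

lemma pPart_map_star (X : Matrix (Fin 4) (Fin 4) ℂ) : (pPart X).map star = pPart (X.map star) := by
  ext i j
  fin_cases i <;> fin_cases j <;> simp [pPart_apply, blockSign, Complex.conj_ofNat]

lemma kPart_map_star (X : Matrix (Fin 4) (Fin 4) ℂ) : (kPart X).map star = kPart (X.map star) := by
  ext i j
  fin_cases i <;> fin_cases j <;> simp [kPart_apply, blockSign, Complex.conj_ofNat]

/-- Conjugation exchanges U and V, giving (V_𝔭)_z - [V_𝔭, U_𝔨]; the 𝔭-part of the Maurer-Cartan
equation identifies this with the original expression. -/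
lemma flatObstruction_map_star (hMC : U₁ - V₁ = U * V - V * U) (hUV : U.map star = V)
    (hU₁ : U₁.map star = V₁) : (flatObstruction U V U₁).map star = flatObstruction U V U₁ := by
  have hVU : V.map star = U := by
    rw [← hUV]; ext i j; simp
  have hp := congrArg pPart hMC
  rw [pPart_sub, pPart_sub, pPart_mul, pPart_mul] at hp
  rw [flatObstruction, Matrix.map_sub _ (by simp), Matrix.map_sub _ (by simp), map_star_mul,
    map_star_mul, pPart_map_star, pPart_map_star, kPart_map_star, hU₁, hUV, hVU]
  rw [← sub_eq_zero] at hp ⊢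
  rw [← neg_eq_zero, ← hp]
  abel

/-- The complexified Lie algebra of the pseudo-orthogonal group. -/
def IsSkew (X : Matrix (Fin 4) (Fin 4) ℂ) : Prop :=
  Xᵀ * complexify (fun _ => etaMat) 0 + complexify (fun _ => etaMat) 0 * X = 0

lemma IsSkew.apply {X : Matrix (Fin 4) (Fin 4) ℂ} (h : IsSkew X) (i j : Fin 4) :
    X j i * blockSign j + blockSign i * X i j = 0 := by
  have h1 := congrFun (congrFun h i) j
  have he : complexify (fun _ => etaMat) 0 = Matrix.diagonal fun i => -blockSign i := by
    ext i j
    fin_cases i <;> fin_cases j <;> simp [complexify, etaMat, blockSign]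
  rw [he, Matrix.add_apply, Matrix.mul_diagonal, Matrix.diagonal_mul] at h1
  simp only [Matrix.transpose_apply, Matrix.zero_apply] at h1
  linear_combination -h1

end Obstruction

/-! ### Skew matrices and their action on the isotropic vector -/

section SkewAlgebra

variable {U V U₁ : Matrix (Fin 4) (Fin 4) ℂ}

/-- The isotropic vector `e₁ + i e₂`. -/
def isoVec : Fin 4 → ℂ := ![1, Complex.I, 0, 0]

lemma IsSkew.entries {X : Matrix (Fin 4) (Fin 4) ℂ} (h : IsSkew X) :
    X 0 0 = 0 ∧ X 1 1 = 0 ∧ X 2 2 = 0 ∧ X 3 3 = 0 ∧ X 1 0 = -X 0 1 ∧ X 3 2 = -X 2 3 ∧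
      X 0 2 = X 2 0 ∧ X 0 3 = X 3 0 ∧ X 1 2 = X 2 1 ∧ X 1 3 = X 3 1 := by
  have e (i j) := h.apply i j
  simp only [blockSign] at e
  have h00 := e 0 0
  have h11 := e 1 1
  have h22 := e 2 2
  have h33 := e 3 3
  have h01 := e 0 1
  have h23 := e 2 3
  have h02 := e 0 2
  have h03 := e 0 3
  have h12 := e 1 2
  have h13 := e 1 3
  simp at h00 h11 h22 h33 h01 h23 h02 h03 h12 h13
  refine ⟨h00, h11, ?_, ?_, ?_, ?_, ?_, ?_, ?_, ?_⟩
  · exact h22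
  · exact h33
  · linear_combination h01
  · linear_combination -h23
  · linear_combination h02
  · linear_combination h03
  · linear_combination h12
  · linear_combination h13

/-- The obstruction applied to `e₁ + i e₂`, as a covariant derivative. -/
lemma flatObstruction_mulVec (hU : IsSkew U) (hV : IsSkew V) :
    flatObstruction U V U₁ *ᵥ isoVec =
      fun i => 1 / 2 * (1 - blockSign i) * (((V * U + U₁) *ᵥ isoVec
        + (1 / 2 * herm (V *ᵥ isoVec) isoVec) • U *ᵥ isoVec
        + (1 / 2 * herm (U *ᵥ isoVec) isoVec) • V *ᵥ isoVec) i) := by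
  obtain ⟨u00, u11, u22, u33, u10, u32, u02, u03, u12, u13⟩ := hU.entries
  obtain ⟨v00, v11, v22, v33, v10, v32, v02, v03, v12, v13⟩ := hV.entries
  -- The vector e₁ + i e₂ is an eigenvector of the 𝔨-parts; as (e₁ + i e₂, e₁ + i e₂) = -2, half the
  -- Hermitian pairing is minus the eigenvalue. The factor (1 - `blockSign i`)/2 selects the last
  -- two coordinates.
  ext i
  fin_cases i <;>
    simp [flatObstruction, Matrix.mulVec, dotProduct, Fin.sum_univ_four, Matrix.mul_apply,
      pPart_apply, kPart_apply, blockSign, isoVec, herm, bil, u00, u11, u22, u33, u10, u32, u02,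
      u03, u12, u13, v00, v11, v22, v33, v10, v32, v02, v03, v12, v13]
  · linear_combination (V 0 1 * U 2 1 + U 0 1 * V 2 1) * Complex.I_mul_I
  · linear_combination (V 0 1 * U 3 1 + U 0 1 * V 3 1) * Complex.I_mul_I

lemma isSkew_of_apply {X : Matrix (Fin 4) (Fin 4) ℂ}
    (h : ∀ i j, X j i * blockSign j + blockSign i * X i j = 0) : IsSkew X := by
  have he : complexify (fun _ => etaMat) 0 = Matrix.diagonal fun i => -blockSign i := by
    ext i j
    fin_cases i <;> fin_cases j <;> simp [complexify, etaMat, blockSign]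
  ext i j
  rw [he, Matrix.add_apply, Matrix.mul_diagonal, Matrix.diagonal_mul]
  simp only [Matrix.transpose_apply, Matrix.zero_apply]
  linear_combination -h i j

lemma IsSkew.pPart (hU : IsSkew U) : IsSkew (pPart U) := isSkew_of_apply fun i j => by
  rw [pPart_apply, pPart_apply]
  linear_combination (1 / 2 * (1 - blockSign i * blockSign j)) * hU.apply i j

lemma IsSkew.kPart (hU : IsSkew U) : IsSkew (kPart U) := isSkew_of_apply fun i j => by
  rw [kPart_apply, kPart_apply]
  linear_combination (1 / 2 * (1 + blockSign i * blockSign j)) * hU.apply i j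

lemma IsSkew.sub (hU : IsSkew U) (hV : IsSkew V) : IsSkew (U - V) :=
  isSkew_of_apply fun i j => by
    rw [Matrix.sub_apply, Matrix.sub_apply]
    linear_combination hU.apply i j - hV.apply i j

lemma IsSkew.commutator (hU : IsSkew U) (hV : IsSkew V) : IsSkew (U * V - V * U) := by
  unfold IsSkew at hU hV ⊢
  rw [← eq_neg_iff_add_eq_zero] at hU hV
  rw [Matrix.transpose_sub, Matrix.transpose_mul, Matrix.transpose_mul, Matrix.sub_mul,
    Matrix.mul_assoc, hU, Matrix.mul_assoc, hV, Matrix.mul_neg, Matrix.mul_neg, ← Matrix.mul_assoc,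
    ← Matrix.mul_assoc, hU, hV]
  noncomm_ring

lemma isSkew_flatObstruction (hU : IsSkew U) (hV : IsSkew V) (hU₁ : IsSkew U₁) :
    IsSkew (flatObstruction U V U₁) := hU₁.pPart.sub (hU.pPart.commutator hV.kPart)

/-- The obstruction is real and skew, so it is determined by its value at `e₁ + i e₂`. -/
lemma flatObstruction_eq_zero_iff (hU : IsSkew U) (hV : IsSkew V) (hU₁ : IsSkew U₁)
    (hr : (flatObstruction U V U₁).map star = flatObstruction U V U₁) :
    flatObstruction U V U₁ = 0 ↔ flatObstruction U V U₁ *ᵥ isoVec = 0 := by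
  constructor
  · intro h; rw [h, Matrix.zero_mulVec]
  intro h
  obtain ⟨-, -, -, -, -, -, e02, e03, e12, e13⟩ := (isSkew_flatObstruction hU hV hU₁).entries
  set P := flatObstruction U V U₁ with hP
  have hre (i j) : star (P i j) = P i j := congrFun (congrFun hr i) j
  -- As P is real, P(e₁ + i e₂) = 0 and its conjugate kill the first two columns separately.
  -- Skewness then gives the upper right block, and the lower right block vanishes on 𝔭.
  have hcol (i) : P i 0 = 0 ∧ P i 1 = 0 := by
    have h1 : P i 0 + Complex.I * P i 1 = 0 := by
      have := congrFun h i
      simp [Matrix.mulVec, dotProduct, Fin.sum_univ_four, isoVec] at this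
      linear_combination this
    have h2 := congrArg star h1
    rw [star_add, star_mul, hre, hre, star_zero, Complex.star_def, Complex.conj_I] at h2
    have h3 : P i 0 = 0 := by linear_combination (h1 + h2) / 2
    refine ⟨h3, ?_⟩
    rw [h3, zero_add] at h1
    exact (mul_eq_zero.1 h1).resolve_left Complex.I_ne_zero
  have e22 (i j : Fin 4) (hi : 2 ≤ i) (hj : 2 ≤ j) : P i j = 0 := by
    fin_cases i <;> fin_cases j <;> simp at hi hj <;>
      simp [hP, flatObstruction, Fin.sum_univ_four, Matrix.mul_apply,
        pPart_apply, kPart_apply, blockSign]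
  ext i j
  fin_cases j
  · exact (hcol i).1
  · exact (hcol i).2
  · fin_cases i
    · exact e02.trans (hcol 2).1
    · exact e12.trans (hcol 2).2
    · exact e22 2 2 le_rfl le_rfl
    · exact e22 3 2 (by decide) le_rfl
  · fin_cases i
    · exact e03.trans (hcol 3).1
    · exact e13.trans (hcol 3).2
    · exact e22 2 3 le_rfl (by decide)
    · exact e22 3 3 (by decide) (by decide)

end SkewAlgebra

/-! ### Pseudo-orthogonal frames over plane domains -/

/-- `η` as a complex matrix. -/
def etaC : Matrix (Fin 4) (Fin 4) ℂ := complexify (fun _ => etaMat) 0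

lemma etaC_eq : etaC = Matrix.diagonal ![-1, -1, 1, 1] := by
  ext i j
  fin_cases i <;> fin_cases j <;> simp [etaC, complexify, etaMat]

lemma etaC_mul_self : etaC * etaC = 1 := by
  rw [etaC_eq, Matrix.diagonal_mul_diagonal, ← Matrix.diagonal_one]
  congr 1
  ext i; fin_cases i <;> simp

lemma etaC_map_star : etaC.map star = etaC := by
  ext i j; simp [etaC, complexify]

lemma herm_eq_dotProduct (x y : Fin 4 → ℂ) : herm x y = x ⬝ᵥ etaC *ᵥ star y := by
  simp [etaC_eq, herm, bil, Matrix.mulVec_diagonal, dotProduct, Fin.sum_univ_four]; ring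

/-- A smooth frame with values in the pseudo-orthogonal group over an open set. -/
structure IsOrthogonalFrame (G : ℂ → Matrix (Fin 4) (Fin 4) ℝ) (D : Set ℂ) : Prop where
  isOpen : IsOpen D
  smooth : ∀ i j, ContDiffOn ℝ ∞ (fun z => G z i j) D
  orthogonal : ∀ z ∈ D, (G z)ᵀ * etaMat * G z = etaMat

/-- The unit lift `(G₁ + i G₂) / √2` given by a frame. -/
def frameLift (G : ℂ → Matrix (Fin 4) (Fin 4) ℝ) (z : ℂ) : Fin 4 → ℂ :=
  ((1 / Real.sqrt 2 : ℝ) : ℂ) • (complexify G z *ᵥ isoVec)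

namespace IsOrthogonalFrame

variable {G : ℂ → Matrix (Fin 4) (Fin 4) ℝ} {D : Set ℂ} {z : ℂ} (h : IsOrthogonalFrame G D)

lemma complexify_map_star : (complexify G z).map star = complexify G z := by
  ext i j; simp [complexify]

include h

lemma eventually_mem (hz : z ∈ D) : ∀ᶠ w in nhds z, w ∈ D := h.isOpen.mem_nhds hz

lemma smoothMatAt (hz : z ∈ D) : SmoothMatAt (complexify G) z := fun i j =>
  Complex.ofRealCLM.contDiff.contDiffAt.comp z ((h.smooth i j).contDiffAt (h.isOpen.mem_nhds hz))

lemma complex_orthogonal (hz : z ∈ D) :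
    (complexify G z)ᵀ * etaC * complexify G z = etaC := by
  have h1 := congrArg (fun A : Matrix (Fin 4) (Fin 4) ℝ => A.map Complex.ofRealHom)
    (h.orthogonal z hz)
  simp only [Matrix.map_mul, Matrix.transpose_map] at h1
  exact h1

lemma left_inv (hz : z ∈ D) :
    (etaC * (complexify G z)ᵀ * etaC) * complexify G z = 1 := by
  rw [Matrix.mul_assoc, Matrix.mul_assoc, ← Matrix.mul_assoc _ etaC, h.complex_orthogonal hz,
    etaC_mul_self]

lemma inv_eq (hz : z ∈ D) :
    (complexify G z)⁻¹ = etaC * (complexify G z)ᵀ * etaC :=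
  Matrix.inv_eq_left_inv (h.left_inv hz)

lemma inv_mul (hz : z ∈ D) : (complexify G z)⁻¹ * complexify G z = 1 := by
  rw [h.inv_eq hz, h.left_inv hz]

lemma mul_inv (hz : z ∈ D) : complexify G z * (complexify G z)⁻¹ = 1 :=
  mul_eq_one_comm.1 (h.inv_mul hz)

lemma mul_mcU (hz : z ∈ D) : complexify G z * mcU G z = matDz (complexify G) z := by
  rw [mcU, ← Matrix.mul_assoc, h.mul_inv hz, Matrix.one_mul]

lemma mul_mcV (hz : z ∈ D) : complexify G z * mcV G z = matDzbar (complexify G) z := by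
  rw [mcV, ← Matrix.mul_assoc, h.mul_inv hz, Matrix.one_mul]

/-- Pseudo-orthogonality makes the inverse linear in the entries of the frame. -/
lemma smooth_inv (hz : z ∈ D) : SmoothMatAt (fun w => (complexify G w)⁻¹) z := by
  have h1 : SmoothMatAt (fun w => etaC * (complexify G w)ᵀ * etaC) z :=
    ((smoothMatAt_const etaC).mul (h.smoothMatAt hz).transpose).mul (smoothMatAt_const etaC)
  exact h1.congr ((h.eventually_mem hz).mono fun w hw => h.inv_eq hw)

lemma smooth_mcU (hz : z ∈ D) : SmoothMatAt (mcU G) z :=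
  (h.smooth_inv hz).mul (h.smoothMatAt hz).matDz

lemma smooth_mcV (hz : z ∈ D) : SmoothMatAt (mcV G) z :=
  (h.smooth_inv hz).mul (h.smoothMatAt hz).matDzbar

omit h in
lemma matDz_map_star_complexify :
    (matDz (complexify G) z).map star = matDzbar (complexify G) z := by
  rw [← matDzbar_map_star]
  congr 1
  exact funext fun _ => complexify_map_star

lemma mcU_map_star (hz : z ∈ D) : (mcU G z).map star = mcV G z := by
  rw [mcU, map_star_mul, matDz_map_star_complexify, mcV, h.inv_eq hz, map_star_mul, map_star_mul,
    Matrix.transpose_map, complexify_map_star, etaC_map_star]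

lemma matDzbar_mcU_map_star (hz : z ∈ D) :
    (matDzbar (mcU G) z).map star = matDz (mcV G) z := by
  rw [← matDz_map_star]
  exact matDz_congr ((h.eventually_mem hz).mono fun w hw => h.mcU_map_star hw)

lemma matDzbar_matDz_complexify (hz : z ∈ D) : matDzbar (matDz (complexify G)) z
    = complexify G z * (mcV G z * mcU G z + matDzbar (mcU G) z) := by
  have h1 : matDz (complexify G) =ᶠ[nhds z] fun w => complexify G w * mcU G w :=
    (h.eventually_mem hz).mono fun w hw => (h.mul_mcU hw).symm
  rw [matDzbar_congr h1, matDzbar_mul (h.smoothMatAt hz) (h.smooth_mcU hz), ← h.mul_mcV hz,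
    Matrix.mul_add, Matrix.mul_assoc]

lemma matDz_matDzbar_complexify (hz : z ∈ D) : matDzbar (matDz (complexify G)) z
    = complexify G z * (mcU G z * mcV G z + matDz (mcV G) z) := by
  have h1 : matDzbar (complexify G) =ᶠ[nhds z] fun w => complexify G w * mcV G w :=
    (h.eventually_mem hz).mono fun w hw => (h.mul_mcV hw).symm
  rw [← matDzbar_matDz (h.smoothMatAt hz), matDz_congr h1,
    matDz_mul (h.smoothMatAt hz) (h.smooth_mcV hz), ← h.mul_mcU hz,
    Matrix.mul_add, Matrix.mul_assoc]

/-- The Maurer-Cartan equation. -/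
lemma maurer_cartan (hz : z ∈ D) : matDzbar (mcU G) z - matDz (mcV G) z
    = mcU G z * mcV G z - mcV G z * mcU G z := by
  have h1 := (h.matDzbar_matDz_complexify hz).symm.trans (h.matDz_matDzbar_complexify hz)
  have h2 := congrArg (fun A => (complexify G z)⁻¹ * A) h1
  simp only [← Matrix.mul_assoc, h.inv_mul hz, Matrix.one_mul] at h2
  rw [sub_eq_sub_iff_add_eq_add, add_comm, h2, add_comm]

lemma isSkew_mcU (hz : z ∈ D) : IsSkew (mcU G z) := by
  have h1 : (fun w => (complexify G w)ᵀ * etaC * complexify G w) =ᶠ[nhds z] fun _ => etaC :=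
    (h.eventually_mem hz).mono fun w hw => h.complex_orthogonal hw
  have h2 := matDz_congr h1
  have hC := h.smoothMatAt hz
  have h3 : matDz (fun w => (complexify G w)ᵀ) z = (matDz (complexify G) z)ᵀ := rfl
  rw [matDz_mul (hC.transpose.mul (smoothMatAt_const _)) hC,
    matDz_mul hC.transpose (smoothMatAt_const _), matDz_const, h3, ← h.mul_mcU hz,
    Matrix.mul_zero, add_zero, Matrix.transpose_mul, Matrix.mul_assoc, Matrix.mul_assoc,
    ← Matrix.mul_assoc _ etaC, h.complex_orthogonal hz, ← Matrix.mul_assoc _ (complexify G z),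
    h.complex_orthogonal hz] at h2
  exact h2

lemma isSkew_mcV (hz : z ∈ D) : IsSkew (mcV G z) := by
  have h1 := congrArg (fun A : Matrix (Fin 4) (Fin 4) ℂ => A.map star) (h.isSkew_mcU hz)
  change _ * etaC + etaC * _ = 0
  rw [← h.mcU_map_star hz]
  change ((mcU G z)ᵀ * etaC + etaC * mcU G z).map star = Matrix.map 0 star at h1
  rw [Matrix.map_add _ (by simp), map_star_mul, map_star_mul, etaC_map_star,
    Matrix.transpose_map, Matrix.map_zero _ (by simp)] at h1
  exact h1

lemma isSkew_matDzbar_mcU (hz : z ∈ D) : IsSkew (matDzbar (mcU G) z) := by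
  refine isSkew_of_apply fun i j => ?_
  have hs := h.smooth_mcU hz
  have h1 : (fun w => blockSign j * mcU G w j i + blockSign i * mcU G w i j)
      =ᶠ[nhds z] fun _ => 0 :=
    (h.eventually_mem hz).mono fun w hw => by
      simpa only [mul_comm] using (h.isSkew_mcU hw).apply i j
  have h2 := dzbar_congr h1
  rw [dzbar_add ((hs j i).diffAt.const_mul _) ((hs i j).diffAt.const_mul _),
    dzbar_const_mul _ (hs j i).diffAt, dzbar_const_mul _ (hs i j).diffAt, dzbar_const] at h2
  rw [mul_comm]
  exact h2

omit h in
lemma star_complexify_mulVec (x : Fin 4 → ℂ) :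
    star (complexify G z *ᵥ x) = complexify G z *ᵥ star x := by
  ext i
  simp [complexify, Matrix.mulVec, dotProduct]

lemma herm_mulVec (hz : z ∈ D) (x y : Fin 4 → ℂ) :
    herm (complexify G z *ᵥ x) (complexify G z *ᵥ y) = herm x y := by
  rw [herm_eq_dotProduct, herm_eq_dotProduct, star_complexify_mulVec, Matrix.mulVec_mulVec,
    ← Matrix.vecMul_transpose, ← Matrix.dotProduct_mulVec, Matrix.mulVec_mulVec,
    ← Matrix.mul_assoc, h.complex_orthogonal hz]

omit h in
lemma inv_sqrt_two_mul_self :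
    ((1 / Real.sqrt 2 : ℝ) : ℂ) * ((1 / Real.sqrt 2 : ℝ) : ℂ) = 1 / 2 := by
  rw [← Complex.ofReal_mul, div_mul_div_comm, Real.mul_self_sqrt (by norm_num)]
  norm_num

omit h in
lemma star_inv_sqrt_two :
    star ((1 / Real.sqrt 2 : ℝ) : ℂ) = ((1 / Real.sqrt 2 : ℝ) : ℂ) := Complex.conj_ofReal _

/-- The lift and its conjugate span the complexified first two columns of the frame, so in frame
coordinates the tangent space is spanned by the last two basis vectors. -/
lemma tanProj_frameLift (hz : z ∈ D) (x : Fin 4 → ℂ) :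
    tanProj (frameLift G z) (complexify G z *ᵥ x)
      = complexify G z *ᵥ fun i => 1 / 2 * (1 - blockSign i) * x i := by
  have hx : (fun i => 1 / 2 * (1 - blockSign i) * x i)
      = x + (1 / 2 * herm x isoVec) • isoVec + (1 / 2 * herm x (star isoVec)) • star isoVec := by
    ext i
    simp only [Pi.add_apply, Pi.smul_apply, Pi.star_apply, smul_eq_mul]
    fin_cases i <;> simp [blockSign, herm, bil, isoVec]
    · ring
    · linear_combination -x 1 * Complex.I_mul_I
    · ring
    · ring
  rw [hx, frameLift, tanProj, star_smul, star_inv_sqrt_two, herm_smul_right, herm_smul_right,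
    star_inv_sqrt_two, star_complexify_mulVec, h.herm_mulVec hz, h.herm_mulVec hz,
    smul_smul, smul_smul, mul_right_comm, inv_sqrt_two_mul_self, mul_right_comm,
    inv_sqrt_two_mul_self, Matrix.mulVec_add, Matrix.mulVec_add, Matrix.mulVec_smul,
    Matrix.mulVec_smul]

omit h in
lemma dz_const_smul {E : Type*} [NormedAddCommGroup E] [NormedSpace ℂ E] (c : ℂ) {f : ℂ → E}
    (hf : DifferentiableAt ℝ f z) : dz (fun w => c • f w) z = c • dz f z := by
  rw [dz_smul (by fun_prop) hf, dz_const, zero_smul, zero_add]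

omit h in
lemma dzbar_const_smul {E : Type*} [NormedAddCommGroup E] [NormedSpace ℂ E] (c : ℂ)
    {f : ℂ → E} (hf : DifferentiableAt ℝ f z) :
    dzbar (fun w => c • f w) z = c • dzbar f z := by
  rw [dzbar_smul (by fun_prop) hf, dzbar_const, zero_smul, zero_add]

omit h in
lemma differentiableAt_mulVec {A : ℂ → Matrix (Fin 4) (Fin 4) ℂ} (hA : SmoothMatAt A z)
    (x : Fin 4 → ℂ) : DifferentiableAt ℝ (fun w => A w *ᵥ x) z :=
  differentiableAt_pi.2 fun i => by
    simp only [Matrix.mulVec, dotProduct]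
    exact (ContDiffAt.sum fun k _ => (hA i k).mul contDiffAt_const).diffAt

lemma dz_frameLift (hz : z ∈ D) : dz (frameLift G) z =
    ((1 / Real.sqrt 2 : ℝ) : ℂ) • (matDz (complexify G) z *ᵥ isoVec) := by
  unfold frameLift
  rw [dz_const_smul _ (differentiableAt_mulVec (h.smoothMatAt hz) _),
    dz_mulVec (h.smoothMatAt hz)]

lemma dzbar_frameLift (hz : z ∈ D) : dzbar (frameLift G) z =
    ((1 / Real.sqrt 2 : ℝ) : ℂ) • (matDzbar (complexify G) z *ᵥ isoVec) := by
  unfold frameLift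
  rw [dzbar_const_smul _ (differentiableAt_mulVec (h.smoothMatAt hz) _),
    dzbar_mulVec (h.smoothMatAt hz)]

lemma dzbar_dz_frameLift (hz : z ∈ D) : dzbar (dz (frameLift G)) z =
    ((1 / Real.sqrt 2 : ℝ) : ℂ) • (matDzbar (matDz (complexify G)) z *ᵥ isoVec) := by
  have h1 : dz (frameLift G) =ᶠ[nhds z] fun w =>
      ((1 / Real.sqrt 2 : ℝ) : ℂ) • (matDz (complexify G) w *ᵥ isoVec) :=
    (h.eventually_mem hz).mono fun w hw => h.dz_frameLift hw
  rw [dzbar_congr h1, dzbar_const_smul _ (differentiableAt_mulVec (h.smoothMatAt hz).matDz _),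
    dzbar_mulVec (h.smoothMatAt hz).matDz]

/-- The tension field in terms of the Maurer-Cartan form. -/
lemma tension_frameLift (hz : z ∈ D) : tension (frameLift G) z =
    ((1 / Real.sqrt 2 : ℝ) : ℂ) • (complexify G z *ᵥ
      (flatObstruction (mcU G z) (mcV G z) (matDzbar (mcU G) z) *ᵥ isoVec)) := by
  have e (x : Fin 4 → ℂ) : herm (((1 / Real.sqrt 2 : ℝ) : ℂ) • (complexify G z *ᵥ x))
      (frameLift G z) = 1 / 2 * herm x isoVec := by
    rw [frameLift, herm_smul_left, herm_smul_right, h.herm_mulVec hz, star_inv_sqrt_two,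
      ← mul_assoc, inv_sqrt_two_mul_self]
  rw [flatObstruction_mulVec (h.isSkew_mcU hz) (h.isSkew_mcV hz), ← h.tanProj_frameLift hz,
    ← tanProj_smul, tension, h.dzbar_dz_frameLift hz, h.matDzbar_matDz_complexify hz,
    h.dz_frameLift hz, h.dzbar_frameLift hz, ← h.mul_mcU hz, ← h.mul_mcV hz,
    ← Matrix.mulVec_mulVec, ← Matrix.mulVec_mulVec, ← Matrix.mulVec_mulVec, e, e,
    Matrix.mulVec_add, Matrix.mulVec_add, Matrix.mulVec_smul, Matrix.mulVec_smul]
  congr 1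
  module

lemma tension_frameLift_eq_zero_iff (hz : z ∈ D) : tension (frameLift G) z = 0 ↔
    flatObstruction (mcU G z) (mcV G z) (matDzbar (mcU G) z) = 0 := by
  have hk : ((1 / Real.sqrt 2 : ℝ) : ℂ) ≠ 0 := Complex.ofReal_ne_zero.2 (by positivity)
  rw [h.tension_frameLift hz, smul_eq_zero, or_iff_right hk, flatObstruction_eq_zero_iff
    (h.isSkew_mcU hz) (h.isSkew_mcV hz) (h.isSkew_matDzbar_mcU hz)
    (flatObstruction_map_star (h.maurer_cartan hz) (h.mcU_map_star hz)
      (h.matDzbar_mcU_map_star hz))]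
  constructor
  · intro h0
    have h1 := congrArg (fun v => (complexify G z)⁻¹ *ᵥ v) h0
    rwa [Matrix.mulVec_mulVec, h.inv_mul hz, Matrix.one_mulVec, Matrix.mulVec_zero] at h1
  · intro h0; rw [h0, Matrix.mulVec_zero]

lemma flat_iff (hz : z ∈ D) {c : ℂ} (hc : c ≠ 0) :
    matDzbar (loopU G c) z - matDz (loopV G c) z
      = loopU G c z * loopV G c z - loopV G c z * loopU G c z ↔
    (c⁻¹ - c) • flatObstruction (mcU G z) (mcV G z) (matDzbar (mcU G) z) = 0 := by
  have hU : matDzbar (loopU G c) z = c⁻¹ • pPart (matDzbar (mcU G) z)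
      + kPart (matDzbar (mcU G) z) := by
    have := matDzbar_loop (h.smooth_mcU hz) c⁻¹ 1
    simp only [one_smul] at this
    exact this
  have hV : matDz (loopV G c) z = kPart (matDz (mcV G) z) + c • pPart (matDz (mcV G) z) := by
    have := matDz_loop (h.smooth_mcV hz) c 1
    simp only [one_smul] at this
    rw [add_comm, ← this]
    congr 1
    exact funext fun w => add_comm _ _
  rw [← loop_curvature (h.maurer_cartan hz) hc, sub_eq_zero (b := _ * _ - _), hU, hV]
  rfl

/-- The curvature is (λ⁻¹ - λ) times the obstruction, so any λ other than ±1 detects it; λ = i gives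
the factor -2i. -/
lemma isLoopFlatOn_iff : IsLoopFlatOn G D ↔ ∀ z ∈ D, tension (frameLift G) z = 0 := by
  constructor
  · intro hl z hz
    have h1 := (h.flat_iff hz Complex.I_ne_zero).1 (hl Complex.I (by simp) z hz)
    rw [h.tension_frameLift_eq_zero_iff hz]
    refine (smul_eq_zero.1 h1).resolve_left ?_
    rw [Complex.inv_I]
    intro h2
    apply Complex.I_ne_zero
    linear_combination (-1 / 2) * h2
  · intro ht c hc z hz
    rw [h.flat_iff hz (by rintro rfl; simp at hc),
      (h.tension_frameLift_eq_zero_iff hz).1 (ht z hz), smul_zero]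

end IsOrthogonalFrame

section Surface

variable {M : Type*} [TopologicalSpace M] [ChartedSpace ℂ M] {f : M → ℙ ℂ (Fin 4 → ℂ)}
  {e : OpenPartialHomeomorph M ℂ} {G : ℂ → Matrix (Fin 4) (Fin 4) ℝ}

lemma IsFrame.isOrthogonalFrame (h : IsFrame f e G) : IsOrthogonalFrame G e.target :=
  ⟨e.open_target, h.smooth, h.orthogonal⟩

lemma IsFrame.isLift_frameLift (h : IsFrame f e G) : IsLift f e (frameLift G) where
  chart := h.chart
  smooth z hz := by
    refine ContDiffAt.contDiffWithinAt (contDiffAt_pi.2 fun i => ?_)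
    simp only [frameLift, Pi.smul_apply, Matrix.mulVec, dotProduct, smul_eq_mul]
    exact contDiffAt_const.mul (ContDiffAt.sum fun k _ =>
      (h.isOrthogonalFrame.smoothMatAt hz i k).mul contDiffAt_const)
  unit z hz := by
    rw [frameLift, herm_smul_left, herm_smul_right, h.isOrthogonalFrame.herm_mulVec hz,
      IsOrthogonalFrame.star_inv_sqrt_two, ← mul_assoc, IsOrthogonalFrame.inv_sqrt_two_mul_self]
    simp [herm, bil, isoVec]
    norm_num
  lift z hz := by
    have hk : ((1 / Real.sqrt 2 : ℝ) : ℂ) ≠ 0 := Complex.ofReal_ne_zero.2 (by positivity)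
    have e1 : frameLift G z = ((1 / Real.sqrt 2 : ℝ) : ℂ) •
        (fun i => (G z i 0 : ℂ) + Complex.I * (G z i 1 : ℂ)) := by
      rw [frameLift]
      congr 1
      ext i
      simp [Matrix.mulVec, dotProduct, Fin.sum_univ_four, isoVec, complexify]
      ring
    obtain ⟨h0, h1⟩ := h.lift z hz
    refine ⟨by rw [e1]; exact smul_ne_zero hk h0, ?_⟩
    rw [h1, Projectivization.mk_eq_mk_iff']
    refine ⟨((1 / Real.sqrt 2 : ℝ) : ℂ)⁻¹, ?_⟩
    rw [e1, smul_smul, inv_mul_cancel₀ hk, one_smul]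

end Surface

/-! ### Existence of frames -/

/-- The real form of signature `(2, 2)`. -/
def realBil (x y : Fin 4 → ℝ) : ℝ := -(x 0 * y 0) - x 1 * y 1 + x 2 * y 2 + x 3 * y 3

/-- The cross product of three vectors with respect to `realBil`. -/
def cross (a b d : Fin 4 → ℝ) : Fin 4 → ℝ :=
  ![-(a 1 * (b 2 * d 3 - b 3 * d 2) - a 2 * (b 1 * d 3 - b 3 * d 1)
      + a 3 * (b 1 * d 2 - b 2 * d 1)),
    a 0 * (b 2 * d 3 - b 3 * d 2) - a 2 * (b 0 * d 3 - b 3 * d 0)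
      + a 3 * (b 0 * d 2 - b 2 * d 0),
    a 0 * (b 1 * d 3 - b 3 * d 1) - a 1 * (b 0 * d 3 - b 3 * d 0)
      + a 3 * (b 0 * d 1 - b 1 * d 0),
    -(a 0 * (b 1 * d 2 - b 2 * d 1) - a 1 * (b 0 * d 2 - b 2 * d 0)
      + a 2 * (b 0 * d 1 - b 1 * d 0))]

lemma realBil_cross_left (a b d : Fin 4 → ℝ) : realBil a (cross a b d) = 0 := by
  simp [realBil, cross]; ring

lemma realBil_cross_mid (a b d : Fin 4 → ℝ) : realBil b (cross a b d) = 0 := by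
  simp [realBil, cross]; ring

lemma realBil_cross_right (a b d : Fin 4 → ℝ) : realBil d (cross a b d) = 0 := by
  simp [realBil, cross]; ring

/-- The right side is the Gram determinant of the three vectors; it enters with sign +1 because det
η = 1. -/
lemma realBil_cross_self (a b d : Fin 4 → ℝ) :
    realBil (cross a b d) (cross a b d) =
      realBil a a * (realBil b b * realBil d d - realBil b d * realBil b d)
      - realBil a b * (realBil a b * realBil d d - realBil b d * realBil a d)
      + realBil a d * (realBil a b * realBil b d - realBil b b * realBil a d) := by
  simp [realBil, cross]; ring

lemma realBil_comm (x y : Fin 4 → ℝ) : realBil x y = realBil y x := by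
  simp only [realBil]; ring

/-- The normalized projection of `e₃` to the orthogonal complement of a negative definite plane
with orthonormal basis `a`, `b`. -/
def thirdVec (a b : Fin 4 → ℝ) : Fin 4 → ℝ := fun i =>
  (√(1 + a 2 ^ 2 + b 2 ^ 2))⁻¹ * ((![0, 0, 1, 0] : Fin 4 → ℝ) i + a 2 * a i + b 2 * b i)

/-- The matrix completing `a`, `b` to a pseudo-orthogonal basis. -/
def completion (a b : Fin 4 → ℝ) : Matrix (Fin 4) (Fin 4) ℝ :=
  Matrix.of fun i j => ![a, b, thirdVec a b, cross a b (thirdVec a b)] j i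

lemma completion_orthogonal {a b : Fin 4 → ℝ} (ha : realBil a a = -1) (hb : realBil b b = -1)
    (hab : realBil a b = 0) :
    (completion a b)ᵀ * etaMat * completion a b = etaMat := by
  set d := thirdVec a b with hd
  -- This is the squared length of e₃ + a₂a + b₂b, the projection of e₃ (indices from 0). It is at
  -- least 1 for every a, b, so the completion is smooth without any choice.
  have hq : 0 < 1 + a 2 ^ 2 + b 2 ^ 2 := by positivity
  have hs := Real.mul_self_sqrt hq.le
  set q := √(1 + a 2 ^ 2 + b 2 ^ 2) with hqd
  have hq0 : q ≠ 0 := (Real.sqrt_pos.2 hq).ne'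
  have had : realBil a d = 0 := by
    have : realBil a d = q⁻¹ * (a 2 + a 2 * realBil a a + b 2 * realBil a b) := by
      simp [hd, thirdVec, realBil, ← hqd]; ring
    rw [this, ha, hab]; ring
  have hbd : realBil b d = 0 := by
    have : realBil b d = q⁻¹ * (b 2 + a 2 * realBil a b + b 2 * realBil b b) := by
      simp [hd, thirdVec, realBil, ← hqd]; ring
    rw [this, hb, hab]; ring
  have hdd : realBil d d = 1 := by
    have : realBil d d = q⁻¹ * q⁻¹ * (1 + 2 * a 2 ^ 2 + 2 * b 2 ^ 2 + a 2 ^ 2 * realBil a a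
        + b 2 ^ 2 * realBil b b + 2 * a 2 * b 2 * realBil a b) := by
      simp [hd, thirdVec, realBil, ← hqd]; ring
    rw [this, ha, hb, hab, show (1 + 2 * a 2 ^ 2 + 2 * b 2 ^ 2 + a 2 ^ 2 * -1 + b 2 ^ 2 * -1
      + 2 * a 2 * b 2 * 0) = q * q by rw [hs]; ring]
    field_simp
  have hcc : realBil (cross a b d) (cross a b d) = 1 := by
    rw [realBil_cross_self, ha, hb, hab, had, hbd, hdd]; ring
  have key (i j : Fin 4) : ((completion a b)ᵀ * etaMat * completion a b) i j =
      realBil (![a, b, d, cross a b d] i) (![a, b, d, cross a b d] j) := by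
    rw [Matrix.mul_assoc, Matrix.mul_apply]
    simp only [etaMat, Matrix.diagonal_mul, Fin.sum_univ_four, completion, realBil,
      Matrix.transpose_apply, Matrix.of_apply, ← hd]
    simp
    ring
  ext i j
  rw [key]
  fin_cases i <;> fin_cases j <;>
    simp [etaMat, ha, hb, hab, had, hbd, hdd, hcc, realBil_cross_left, realBil_cross_mid,
      realBil_cross_right, realBil_comm b a, realBil_comm d a, realBil_comm d b,
      realBil_comm (cross a b d) a, realBil_comm (cross a b d) b, realBil_comm (cross a b d) d]

lemma contDiffOn_completion {a b : ℂ → Fin 4 → ℝ} {D : Set ℂ}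
    (ha : ∀ i, ContDiffOn ℝ ∞ (fun z => a z i) D) (hb : ∀ i, ContDiffOn ℝ ∞ (fun z => b z i) D)
    (i j : Fin 4) : ContDiffOn ℝ ∞ (fun z => completion (a z) (b z) i j) D := by
  have hd (k : Fin 4) : ContDiffOn ℝ ∞ (fun z => thirdVec (a z) (b z) k) D := by
    unfold thirdVec
    have hq (z : ℂ) : 0 < 1 + a z 2 ^ 2 + b z 2 ^ 2 := by positivity
    have h1 : ContDiffOn ℝ ∞ (fun z => 1 + a z 2 ^ 2 + b z 2 ^ 2) D :=
      (contDiffOn_const.add ((ha 2).pow 2)).add ((hb 2).pow 2)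
    exact ((h1.sqrt fun z _ => (hq z).ne').inv fun z _ => (Real.sqrt_pos.2 (hq z)).ne').mul
      ((contDiffOn_const.add ((ha 2).mul (ha k))).add ((hb 2).mul (hb k)))
  fin_cases j
  · exact ha i
  · exact hb i
  · exact hd i
  · have ha0 := ha 0
    have ha1 := ha 1
    have ha2 := ha 2
    have ha3 := ha 3
    have hb0 := hb 0
    have hb1 := hb 1
    have hb2 := hb 2
    have hb3 := hb 3
    have hd0 := hd 0
    have hd1 := hd 1
    have hd2 := hd 2
    have hd3 := hd 3
    fin_cases i <;> simp [completion, cross] <;> fun_prop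

section Surface

variable {M : Type*} [TopologicalSpace M] [ChartedSpace ℂ M] {f : M → ℙ ℂ (Fin 4 → ℂ)}
  {e : OpenPartialHomeomorph M ℂ} {F : ℂ → Fin 4 → ℂ}

/-- Every lift is, up to scale, given by the first two columns of a frame. -/
lemma IsLift.exists_isFrame (h : IsLift f e F) (hf : IsConformalLagrangianImmersion f) :
    ∃ G, IsFrame f e G := by
  have hL := h.isLagrangianLift hf
  have hs : √2 * √2 = 2 := Real.mul_self_sqrt (by norm_num)
  -- The equations (F, F) = -1 and Re⟨F, F⟩ = 0, added and subtracted, make √2 Re F and √2 Im F unit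
  -- negative vectors; Im⟨F, F⟩ = 0 makes them orthogonal.
  refine ⟨fun z => completion (fun i => √2 * (F z i).re) (fun i => √2 * (F z i).im),
    h.chart, ?_, ?_, ?_⟩
  · have hF (i : Fin 4) : ContDiffOn ℝ ∞ (fun z => F z i) e.target :=
      contDiffOn_pi.1 h.smooth i
    exact contDiffOn_completion
      (fun i => contDiffOn_const.mul (Complex.reCLM.contDiff.comp_contDiffOn (hF i)))
      (fun i => contDiffOn_const.mul (Complex.imCLM.contDiff.comp_contDiffOn (hF i)))
  · intro z hz
    have h1 := congrArg Complex.re (hL.unit z hz)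
    have h2 := congrArg Complex.re (hL.null z hz)
    have h3 := congrArg Complex.im (hL.null z hz)
    simp [herm, bil] at h1 h2 h3
    apply completion_orthogonal
    · simp only [realBil]
      linear_combination (-(F z 0).re ^ 2 - (F z 1).re ^ 2 + (F z 2).re ^ 2
        + (F z 3).re ^ 2) * hs + h1 + h2
    · simp only [realBil]
      linear_combination (-(F z 0).im ^ 2 - (F z 1).im ^ 2 + (F z 2).im ^ 2
        + (F z 3).im ^ 2) * hs + h1 - h2
    · simp only [realBil]
      linear_combination (-(F z 0).re * (F z 0).im - (F z 1).re * (F z 1).im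
        + (F z 2).re * (F z 2).im + (F z 3).re * (F z 3).im) * hs + h3
  · intro z hz
    have e1 : (fun i => ((completion (fun i => √2 * (F z i).re) (fun i => √2 * (F z i).im) i 0
        : ℝ) : ℂ) + Complex.I * ((completion (fun i => √2 * (F z i).re)
          (fun i => √2 * (F z i).im) i 1 : ℝ) : ℂ)) = ((√2 : ℝ) : ℂ) • F z := by
      ext i
      simp only [completion, Matrix.of_apply, Matrix.cons_val_zero, Matrix.cons_val_one,
        Pi.smul_apply, smul_eq_mul, Complex.ofReal_mul]
      linear_combination ((√2 : ℝ) : ℂ) * Complex.re_add_im (F z i)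
    have hk : ((√2 : ℝ) : ℂ) ≠ 0 := Complex.ofReal_ne_zero.2 (by positivity)
    obtain ⟨h0, h1⟩ := h.lift z hz
    refine ⟨by rw [e1]; exact smul_ne_zero hk h0, ?_⟩
    rw [h1, Projectivization.mk_eq_mk_iff']
    refine ⟨((√2 : ℝ) : ℂ)⁻¹, ?_⟩
    rw [e1, smul_smul, inv_mul_cancel₀ hk, one_smul]

end Surface

/-! ### Existence of horizontal lifts -/

lemma fderiv_herm {f g : ℂ → Fin 4 → ℂ} {z : ℂ} (hf : DifferentiableAt ℝ f z)
    (hg : DifferentiableAt ℝ g z) (X : ℂ) :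
    fderiv ℝ (fun w => herm (f w) (g w)) z X
      = herm (fderiv ℝ f z X) (g z) + herm (f z) (fderiv ℝ g z X) := by
  rw [fderiv_eq_dz_add_dzbar, fderiv_eq_dz_add_dzbar, fderiv_eq_dz_add_dzbar, dz_herm hf hg,
    dzbar_herm hf hg]
  simp only [herm_add_left, herm_add_right, herm_smul_left, herm_smul_right, smul_eq_mul,
    star_star]
  ring

namespace IsLagrangianLift

variable {F : ℂ → Fin 4 → ℂ} {D : Set ℂ} {z : ℂ} (h : IsLagrangianLift F D)
include h

lemma star_herm_fderiv (hz : z ∈ D) (X : ℂ) :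
    herm (F z) (fderiv ℝ F z X) = -herm (fderiv ℝ F z X) (F z) := by
  have h1 : (fun w => herm (F w) (F w)) =ᶠ[nhds z] fun _ => -1 := by
    filter_upwards [h.eventually_mem hz] with w hw using h.unit w hw
  have h2 := fderiv_herm (h.differentiableAt hz) (h.differentiableAt hz) X
  rw [h1.fderiv_eq, fderiv_fun_const] at h2
  simp at h2
  linear_combination -h2

lemma herm_fderiv_re (hz : z ∈ D) (X : ℂ) : (herm (fderiv ℝ F z X) (F z)).re = 0 := by
  have h1 := congrArg Complex.re (h.star_herm_fderiv hz X)
  rw [← star_herm] at h1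
  simp at h1
  linarith

/-- The induced form differs from this pairing by (dF X, F) times the conjugate of (dF Y, F), which
is real because both factors are imaginary. -/
lemma herm_fderiv_fderiv_im (hz : z ∈ D) (X Y : ℂ) :
    (herm (fderiv ℝ F z X) (fderiv ℝ F z Y)).im = 0 := by
  have h1 := h.lagrangian z hz X Y
  simp only [inducedForm, diffMap, hor, herm_add_left, herm_add_right, herm_smul_left,
    herm_smul_right, h.unit z hz, h.star_herm_fderiv hz, star_herm] at h1
  simp [h.herm_fderiv_re hz] at h1
  linarith

/-- The product rule also yields Im(dF X, dF Y), which the Lagrangian condition kills. What remains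
is symmetric in X and Y, so the connection form is closed. -/
lemma fderiv_connection (hz : z ∈ D) (X Y : ℂ) :
    fderiv ℝ (fun w => (herm (fderiv ℝ F w X) (F w)).im) z Y
      = (herm (fderiv ℝ (fderiv ℝ F) z Y X) (F z)).im := by
  have h1 : DifferentiableAt ℝ (fderiv ℝ F) z :=
    (contDiffAt_fderiv (h.contDiffAt hz)).diffAt
  have h2 : DifferentiableAt ℝ (fun w => fderiv ℝ F w X) z := h1.clm_apply (by fun_prop)
  have h3 : DifferentiableAt ℝ (fun w => herm (fderiv ℝ F w X) (F w)) z := by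
    have h4 : ContDiffAt ℝ ∞ (fun w => fderiv ℝ F w X) z :=
      (contDiffAt_fderiv (h.contDiffAt hz)).clm_apply contDiffAt_const
    exact (contDiffAt_herm h4 (h.contDiffAt hz)).diffAt
  have h5 := (Complex.imCLM.hasFDerivAt.comp z h3.hasFDerivAt).fderiv
  have h6 : fderiv ℝ (fun w => fderiv ℝ F w X) z Y = fderiv ℝ (fderiv ℝ F) z Y X := by
    rw [fderiv_clm_apply h1 (by fun_prop)]; simp
  have h7 : fderiv ℝ (fun w => (herm (fderiv ℝ F w X) (F w)).im) z Y
      = (fderiv ℝ (fun w => herm (fderiv ℝ F w X) (F w)) z Y).im := by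
    exact congrArg (fun L : ℂ →L[ℝ] ℝ => L Y) h5
  rw [h7, fderiv_herm h2 (h.differentiableAt hz), h6, Complex.add_im,
    h.herm_fderiv_fderiv_im hz, add_zero]

/-- Over a convex set, the phase of a lift can be changed so that it becomes horizontal. -/
lemma exists_phase {B : Set ℂ} (hB : Convex ℝ B) (hBo : IsOpen B) (hBD : B ⊆ D) :
    ∃ φ : ℂ → ℝ, ContDiffOn ℝ ∞ φ B ∧ ∀ w ∈ B,
      fderiv ℝ φ w 1 = (herm (fderiv ℝ F w 1) (F w)).im ∧
      fderiv ℝ φ w Complex.I = (herm (fderiv ℝ F w Complex.I) (F w)).im := by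
  set p : ℂ → ℂ → ℝ := fun X w => (herm (fderiv ℝ F w X) (F w)).im with hp
  have hps (X : ℂ) {w : ℂ} (hw : w ∈ D) : ContDiffAt ℝ ∞ (p X) w := by
    have h4 : ContDiffAt ℝ ∞ (fun w => fderiv ℝ F w X) w :=
      (contDiffAt_fderiv (h.contDiffAt hw)).clm_apply contDiffAt_const
    exact Complex.imCLM.contDiff.contDiffAt.comp w (contDiffAt_herm h4 (h.contDiffAt hw))
  -- The connection form Im(dF, F) in the basis dx, dy; a primitive φ comes from the Poincaré lemma
  -- on the convex set, and is smooth because its derivative ζ is.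
  set ζ : ℂ → ℂ →L[ℝ] ℝ := fun w => p 1 w • Complex.reCLM + p Complex.I w • Complex.imCLM with hζ
  have hζs {w : ℂ} (hw : w ∈ D) : ContDiffAt ℝ ∞ ζ w :=
    ((hps 1 hw).smul contDiffAt_const).add ((hps Complex.I hw).smul contDiffAt_const)
  have hζd {w : ℂ} (hw : w ∈ D) : HasFDerivAt ζ
      ((fderiv ℝ (p 1) w).smulRight Complex.reCLM
        + (fderiv ℝ (p Complex.I) w).smulRight Complex.imCLM) w := by
    have h1 := ((hps 1 hw).differentiableAt (by simp)).hasFDerivAt.smul_const Complex.reCLM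
    have h2 := ((hps Complex.I hw).differentiableAt (by simp)).hasFDerivAt.smul_const Complex.imCLM
    exact h1.add h2
  have hsymm : ∀ a ∈ B, ∀ X Y : ℂ, ((fderiv ℝ (p 1) a).smulRight Complex.reCLM
        + (fderiv ℝ (p Complex.I) a).smulRight Complex.imCLM) X Y
      = ((fderiv ℝ (p 1) a).smulRight Complex.reCLM
        + (fderiv ℝ (p Complex.I) a).smulRight Complex.imCLM) Y X := by
    intro a ha X Y
    have hsy : IsSymmSndFDerivAt ℝ F a :=
      (h.contDiffAt (hBD ha)).isSymmSndFDerivAt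
        (by simp; exact WithTop.coe_le_coe.2 (le_top : (2 : ℕ∞) ≤ ⊤))
    have h1 : fderiv ℝ (p 1) a Complex.I = fderiv ℝ (p Complex.I) a 1 := by
      rw [hp, h.fderiv_connection (hBD ha), h.fderiv_connection (hBD ha), hsy]
    have h2 (L : ℂ →L[ℝ] ℝ) (X : ℂ) : L X = X.re * L 1 + X.im * L Complex.I := by
      conv_lhs => rw [show X = X.re • (1 : ℂ) + X.im • Complex.I by
        apply Complex.ext <;> simp]
      rw [map_add, map_smul, map_smul, smul_eq_mul, smul_eq_mul]
    simp only [add_apply, ContinuousLinearMap.smulRight_apply, smul_apply,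
      Complex.reCLM_apply, Complex.imCLM_apply, smul_eq_mul]
    rw [h2 (fderiv ℝ (p 1) a) X, h2 (fderiv ℝ (p 1) a) Y, h2 (fderiv ℝ (p Complex.I) a) X,
      h2 (fderiv ℝ (p Complex.I) a) Y, h1]
    ring
  obtain ⟨φ, hφ⟩ := hB.exists_forall_hasFDerivWithinAt_of_hasFDerivWithinAt_symmetric
    (fun x hx => (hζd (hBD hx)).hasFDerivWithinAt) (fun a ha x _ y _ => hsymm a ha x y)
  have hφ' : ∀ w ∈ B, HasFDerivAt φ (ζ w) w := fun w hw =>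
    (hφ w hw).hasFDerivAt (hBo.mem_nhds hw)
  refine ⟨φ, ?_, ?_⟩
  · rw [contDiffOn_infty_iff_fderiv_of_isOpen hBo]
    refine ⟨fun w hw => (hφ' w hw).differentiableAt.differentiableWithinAt, ?_⟩
    refine ContDiffOn.congr (fun w hw => (hζs (hBD hw)).contDiffWithinAt) ?_
    exact fun w hw => (hφ' w hw).fderiv
  · intro w hw
    rw [(hφ' w hw).fderiv]
    simp [hζ, hp]

end IsLagrangianLift

/-! ### Local horizontal lifts and the local nature of minimality -/

section Surface

variable {M : Type*} [TopologicalSpace M] [ChartedSpace ℂ M] {f : M → ℙ ℂ (Fin 4 → ℂ)}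
  {e : OpenPartialHomeomorph M ℂ} {F : ℂ → Fin 4 → ℂ}

/-- Shrinking the coordinate to a ball makes the target connected and the connection form exact.
Multiplying by e^{iφ} adds -i dφ to (dF, F), which cancels it when dφ = Im(dF, F), the real part
being zero. -/
lemma IsLift.exists_isHorizontalLift (h : IsLift f e F)
    (hf : IsConformalLagrangianImmersion f) {p : M} (hp : p ∈ e.source) :
    ∃ (e' : OpenPartialHomeomorph M ℂ) (F' : ℂ → Fin 4 → ℂ), p ∈ e'.source ∧
      IsConnected e'.target ∧ IsHorizontalLift f e' F' := by
  have hL := h.isLagrangianLift hf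
  obtain ⟨r, hr, hball⟩ := Metric.isOpen_iff.1 e.open_target (e p) (e.map_source hp)
  set B := Metric.ball (e p) r with hB
  obtain ⟨φ, hφ, hφd⟩ := hL.exists_phase (convex_ball _ _) Metric.isOpen_ball hball
  set s : Set M := e.source ∩ e ⁻¹' B with hs
  have hso : IsOpen s := e.isOpen_inter_preimage Metric.isOpen_ball
  have htarget : (e.restr s).target = B := by
    ext w
    rw [OpenPartialHomeomorph.restr_target, hso.interior_eq]
    simp only [Set.mem_inter_iff, Set.mem_preimage, hs]
    constructor
    · rintro ⟨h1, -, h2⟩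
      rwa [e.right_inv h1] at h2
    · intro h1
      have h2 := hball h1
      exact ⟨h2, e.map_target h2, by rwa [e.right_inv h2]⟩
  set c : ℂ → ℂ := fun w => Complex.exp (φ w * Complex.I) with hc
  have hcc (w : ℂ) : c w * star (c w) = 1 := by
    have : star (c w) = Complex.exp (-(φ w * Complex.I)) := by
      rw [hc, Complex.star_def, ← Complex.exp_conj]; simp
    rw [this, hc, ← Complex.exp_add]; simp
  have hcs : ContDiffOn ℝ ∞ c B := by
    have h1 : ContDiffOn ℝ ∞ (fun w => (φ w : ℂ)) B :=
      Complex.ofRealCLM.contDiff.comp_contDiffOn hφ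
    exact (h1.mul contDiffOn_const).cexp
  refine ⟨e.restr s, fun w => c w • F w, ?_, ?_, ⟨?_, ?_, ?_, ?_⟩, ?_⟩
  · rw [e.restr_source' s hso]
    exact ⟨hp, hp, Metric.mem_ball_self hr⟩
  · rw [htarget]
    exact (convex_ball _ _).isConnected ⟨e p, Metric.mem_ball_self hr⟩
  · exact restr_mem_maximalAtlas _ h.chart hso
  · rw [htarget]
    exact hcs.smul (h.smooth.mono hball)
  · intro w hw
    rw [htarget] at hw
    rw [herm_smul_left, herm_smul_right, h.unit w (hball hw)]
    linear_combination -hcc w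
  · intro w hw
    rw [htarget] at hw
    obtain ⟨h0, h1⟩ := h.lift w (hball hw)
    have hc0 : c w ≠ 0 := Complex.exp_ne_zero _
    refine ⟨smul_ne_zero hc0 h0, ?_⟩
    change f (e.symm w) = _
    rw [h1, Projectivization.mk_eq_mk_iff']
    exact ⟨(c w)⁻¹, by rw [smul_smul, inv_mul_cancel₀ hc0, one_smul]⟩
  · intro w hw
    rw [htarget] at hw
    have hcd : DifferentiableAt ℝ c w :=
      (hcs.contDiffAt (Metric.isOpen_ball.mem_nhds hw)).diffAt
    have hφw : DifferentiableAt ℝ φ w :=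
      (hφ.contDiffAt (Metric.isOpen_ball.mem_nhds hw)).differentiableAt (by simp)
    have hFd := hL.differentiableAt (hball hw)
    have hcX (X : ℂ) : fderiv ℝ c w X = c w * (fderiv ℝ φ w X * Complex.I) := by
      have h1 : HasFDerivAt (fun w => (φ w : ℂ) * Complex.I)
          ((Complex.ofRealCLM.comp (fderiv ℝ φ w)).smulRight Complex.I) w :=
        (Complex.ofRealCLM.hasFDerivAt.comp w hφw.hasFDerivAt).smul_const Complex.I
      have h2 := h1.cexp.fderiv
      rw [hc, h2]
      simp
    have key (X : ℂ) (hX : fderiv ℝ φ w X = (herm (fderiv ℝ F w X) (F w)).im) :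
        herm (fderiv ℝ (fun w => c w • F w) w X) (c w • F w) = 0 := by
      have h2 : herm (fderiv ℝ F w X) (F w) = (fderiv ℝ φ w X : ℂ) * Complex.I := by
        apply Complex.ext <;> simp [hX, hL.herm_fderiv_re (hball hw)]
      rw [fderiv_fun_smul hcd hFd]
      simp only [add_apply, smul_apply, ContinuousLinearMap.smulRight_apply, hcX,
        herm_add_left, herm_smul_left, herm_smul_right, h.unit w (hball hw), h2]
      ring
    have k1 := key 1 (hφd w hw).1
    have k2 := key Complex.I (hφd w hw).2
    constructor
    · rw [dz, herm_smul_left, herm_sub_left, herm_smul_left, k1, k2]; simp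
    · rw [dzbar, herm_smul_left, herm_add_left, herm_smul_left, k1, k2]; simp

lemma IsHorizontalLift.isHorizontalLagrangianLift (h : IsHorizontalLift f e F)
    (hf : IsConformalLagrangianImmersion f) : IsHorizontalLagrangianLift F e.target :=
  ⟨h.toIsLift.isLagrangianLift hf, h.horizontal⟩

lemma IsMinimal.isMinimalOn (h : IsMinimal f) (S : Set M) : IsMinimalOn f S :=
  fun e F hF z hz _ => h e F hF z hz (Set.mem_univ _)

lemma isMinimal_of_locally (h : ∀ p : M, ∃ S : Set M, p ∈ S ∧ IsMinimalOn f S) : IsMinimal f := by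
  intro e F hF z hz _
  obtain ⟨S, hS, hm⟩ := h (e.symm z)
  exact hm e F hF z hz hS

variable [IsManifold 𝓘(ℂ) ω M]

lemma IsFrame.isLoopFlatOn_iff {G : ℂ → Matrix (Fin 4) (Fin 4) ℝ} (h : IsFrame f e G)
    (hf : IsConformalLagrangianImmersion f) :
    IsLoopFlatOn G e.target ↔ IsMinimalOn f e.source := by
  rw [h.isOrthogonalFrame.isLoopFlatOn_iff, isMinimalOn_iff_tension hf h.isLift_frameLift]

lemma IsHorizontalLift.isMinimalOn_iff (h : IsHorizontalLift f e F)
    (hf : IsConformalLagrangianImmersion f) (he : IsPreconnected e.target) :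
    IsMinimalOn f e.source ↔
      DifferentiableOn ℂ (alphaFun F) e.target ∧ HasConstantPhase (betaFun F) e.target := by
  rw [isMinimalOn_iff_tension hf h.toIsLift,
    (h.isHorizontalLagrangianLift hf).tension_eq_zero_iff_alpha_beta he]

end Surface

end HypQuadric

end

/-! ### The local and global equivalences -/

theorem theorem1p2 {M : Type*} [TopologicalSpace M] [ChartedSpace ℂ M] [IsManifold 𝓘(ℂ) ω M]
    (f : M → ℙ ℂ (Fin 4 → ℂ)) (hf : IsConformalLagrangianImmersion f) :
    -- the equivalences over each coordinate domain, for each horizontal lift and each frame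
    (∀ (e : OpenPartialHomeomorph M ℂ) (F : ℂ → Fin 4 → ℂ) (G : ℂ → Matrix (Fin 4) (Fin 4) ℝ),
      IsConnected e.target → IsHorizontalLift f e F → IsFrame f e G →
        List.TFAE
          [ IsMinimalOn f e.source,
            IsLoopFlatOn G e.target,
            DifferentiableOn ℂ (alphaFun F) e.target ∧ HasConstantPhase (betaFun F) e.target ] ∧
        ((∀ z ∈ e.target, betaFun F z ≠ 0) →
          List.TFAE
            [ IsMinimalOn f e.source,
              IsLoopFlatOn G e.target,
              DifferentiableOn ℂ (alphaFun F) e.target ∧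
                ∃ φ : ℝ, ∀ z ∈ e.target, Complex.arg (betaFun F z) = φ ])) ∧
    -- the equivalences over the whole surface
    List.TFAE
      [ IsMinimal f,
        ∀ (e : OpenPartialHomeomorph M ℂ) (G : ℂ → Matrix (Fin 4) (Fin 4) ℝ),
          IsFrame f e G → IsLoopFlatOn G e.target,
        ∀ (e : OpenPartialHomeomorph M ℂ) (F : ℂ → Fin 4 → ℂ),
          IsConnected e.target → IsHorizontalLift f e F →
            DifferentiableOn ℂ (alphaFun F) e.target ∧
              HasConstantPhase (betaFun F) e.target ] := by
  refine ⟨fun e F G he hF hG => ?_, ?_⟩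
  · have h12 := hG.isLoopFlatOn_iff hf
    have h13 := hF.isMinimalOn_iff hf he.isPreconnected
    refine ⟨?_, fun hβ => ?_⟩
    · tfae_have 1 ↔ 2 := h12.symm
      tfae_have 1 ↔ 3 := h13
      tfae_finish
    · have hL := hF.isHorizontalLagrangianLift hf
      -- Without zeros of β, a continuous function on a connected domain, constant phase can be
      -- rewritten as constant argument in the equivalence already obtained.
      rw [hasConstantPhase_iff_arg he.isPreconnected
        (fun z hz => (hL.differentiableAt_beta hz).continuousAt.continuousWithinAt) hβ] at h13
      tfae_have 1 ↔ 2 := h12.symm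
      tfae_have 1 ↔ 3 := h13
      tfae_finish
  · tfae_have 1 → 2 := fun h e G hG => (hG.isLoopFlatOn_iff hf).2 (h.isMinimalOn _)
    tfae_have 1 → 3 := fun h e F he hF =>
      (hF.isMinimalOn_iff hf he.isPreconnected).1 (h.isMinimalOn _)
    -- Conditions 2 and 3 speak only of existing frames and horizontal lifts, so one of each near
    -- every point is needed to return to minimality.
    tfae_have 2 → 1 := fun h => isMinimal_of_locally fun p => by
      obtain ⟨e, F, hF, hp⟩ := hf.smooth p
      obtain ⟨G, hG⟩ := hF.exists_isFrame hf
      exact ⟨e.source, hp, (hG.isLoopFlatOn_iff hf).1 (h e G hG)⟩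
    tfae_have 3 → 1 := fun h => isMinimal_of_locally fun p => by
      obtain ⟨e, F, hF, hp⟩ := hf.smooth p
      obtain ⟨e', F', hp', he', hF'⟩ := hF.exists_isHorizontalLift hf hp
      exact ⟨e'.source, hp', (hF'.isMinimalOn_iff hf he'.isPreconnected).2 (h e' F' he' hF')⟩
    tfae_finish
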